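/- Let $\mathcal M$ be a finite-dimensional smooth Riemannian manifold that is (geodesically) complete, so that $\mathrm{Exp}_x$ is defined on all of $T_x\mathcal M$ for every $x$. Write $\mathrm{Exp}_x^{-1}(y)$ for a fixed choice of a shortest $v\in T_x\mathcal M$ with $\mathrm{Exp}_x(v)=y$ (the only such $v$ if geodesics are unique), and $\Gamma_x^y$ for the parallel transport $T_x\mathcal M\to T_y\mathcal M$ along $s\mapsto \mathrm{Exp}_x(s\,\mathrm{Exp}_x^{-1}(y))$, $0\le s\le 1$. A differentiable function $h:\mathcal M\to\mathbb R$ is called geodesically $L$-smooth if $\|\nabla h(x)-\Gamma_y^x\nabla h(y)\|\le L\|v\|$ whenever a geodesic $\gamma$ with $\gamma(0)=x$, $\dot\gamma(0)=v$ has $\gamma(1)=y$, where here $\Gamma_y^x$ is the parallel transport along this geodesic from $y$ to $x$. Let $n\ge 1$, $L>0$, $\epsilon>0$, let $f_1,\dots,f_n:\mathcal M\to\mathbb R$ be geodesically $L$-smooth, and let $f=\frac1n\sum_{i=1}^n f_i$ be bounded below. Fix $x_0\in\mathcal M$, put $M=f(x_0)-\inf f$, $\eta=\frac1{2L}$, $q=\lceil\sqrt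 n\rceil$, and let $T\ge 1$ be the integer obtained by rounding $4ML/\epsilon^2$ up or down. Consider the algorithm (R-SPIDER-nonconvex) which, in passes $t=0,1,2,\dots$, does the following. * If $q\mid t$, it sets $v_t=\nabla f(x_t)$ (full batch, $n$ samples). * Otherwise it draws a sample of $$S_t=\left\lceil\min\left\{n,\ \frac{qL^2\|\mathrm{Exp}_{x_{t-1}}^{-1}(x_t)\|^2}{2\epsilon^2}\right\}\right\rceil$$ indices uniformly from $\{1,\dots,n\}$, independently of the past, and sets $$v_t=\nabla f_{S_t}(x_t)-\Gamma_{x_{t-1}}^{x_t}\big[\nabla f_{S_t}(x_{t-1})-v_{t-1}\big],$$ where $\nabla f_{S_t}$ is the average of the $\nabla f_i$ over the sample. The sample may be drawn with or without replacement; $n$ samples always mean the full batch, and the average over an empty sample is $0$. * It sets $x_{t+1}=\mathrm{Exp}_{x_t}(-\eta v_t)$. The algorithm stops after the $T$ passes $t=0,\dots,T-1$, and its output $x$ is drawn uniformly from $\{x_1,\dots,x_T\}$. Each evaluation of a $\nabla f_i$ at a point is one IFO call, so a pass costs $n$ calls if $q\mid t$ and $2S_t$ calls otherwise. Then the algorithm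 terminates after exactly $T$ passes, $$\mathbb E\big[\|\nabla f(x)\|^2\big]\le 10\,\epsilon^2,$$ and the expected number of IFO calls is less than $$n+\frac{8ML(3+\sqrt n)}{\epsilon^2}.$$ The same strict bound holds with the further pass $t=T$ included if $T\le 4ML/\epsilon^2$. In particular the expected number of IFO calls of the $T$ passes is at most $n+32ML\,\sqrt n/\epsilon^2$, that is, $O(n+\sqrt n/\epsilon^2)$ for fixed $M$ and $L$. -/

import Mathlib

open Bundle Manifold
open scoped ContDiff BigOperators

noncomputable section

namespace RSpider

section Geometry

variable {E : Type*} [NormedAddCommGroup E] [NormedSpace ℝ E]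
  {M : Type*} [TopologicalSpace M] [ChartedSpace E M] [IsManifold 𝓘(ℝ, E) ∞ M]
  [RiemannianBundle (fun x : M ↦ TangentSpace 𝓘(ℝ, E) x)]

/-- The matrix of the Riemannian metric in the chart centred at `x₀`: the inner product, at the
point with coordinates `p`, of the tangent vectors with coordinates `u` and `w`. -/
def chartMetric (x₀ : M) (p u w : E) : ℝ :=
  let d := mfderiv 𝓘(ℝ, E) 𝓘(ℝ, E) (extChartAt 𝓘(ℝ, E) x₀).symm p
  inner ℝ (d u : TangentSpace 𝓘(ℝ, E) ((extChartAt 𝓘(ℝ, E) x₀).symm p))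
    (d w : TangentSpace 𝓘(ℝ, E) ((extChartAt 𝓘(ℝ, E) x₀).symm p))

/-- The Christoffel symbols of the first kind of the Levi-Civita connection in the chart centred
at `x₀`, at the point with coordinates `p`:
`Γ(u, v; w) = (∂_u g(v, w) + ∂_v g(u, w) - ∂_w g(u, v)) / 2`. -/
def christoffel (x₀ : M) (p u v w : E) : ℝ :=
  (fderiv ℝ (fun p' ↦ chartMetric x₀ p' v w) p u
    + fderiv ℝ (fun p' ↦ chartMetric x₀ p' u w) p v
    - fderiv ℝ (fun p' ↦ chartMetric x₀ p' u v) p w) / 2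

/-- The vector field `V` along the curve `γ` is parallel for the Levi-Civita connection. In every
chart, with `c` the coordinates of `γ` and `a` those of `V`, this is the equation
`a' + Γ(c', a) = 0`, tested against all vectors `w` through the metric. -/
def IsParallelAlong (γ : ℝ → M) (V : ∀ t, TangentSpace 𝓘(ℝ, E) (γ t)) : Prop :=
  ∀ (t : ℝ) (x₀ : M), γ t ∈ (chartAt E x₀).source →
    let c : ℝ → E := fun s ↦ extChartAt 𝓘(ℝ, E) x₀ (γ s)
    let a : ℝ → E := fun s ↦ mfderiv 𝓘(ℝ, E) 𝓘(ℝ, E) (extChartAt 𝓘(ℝ, E) x₀) (γ s) (V s)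
    DifferentiableAt ℝ a t ∧
      ∀ w : E, chartMetric x₀ (c t) (deriv a t) w
        + christoffel x₀ (c t) (deriv c t) (a t) w = 0

/-- The velocity of a curve. -/
def velocity (γ : ℝ → M) (t : ℝ) : TangentSpace 𝓘(ℝ, E) (γ t) :=
  mfderiv 𝓘(ℝ, ℝ) 𝓘(ℝ, E) γ t (1 : ℝ)

/-- Geodesics (defined for all times): smooth curves whose velocity is parallel. -/
def IsGeodesic (γ : ℝ → M) : Prop :=
  ContMDiff 𝓘(ℝ, ℝ) 𝓘(ℝ, E) ∞ γ ∧ IsParallelAlong (E := E) γ (velocity γ)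

/-- `γ` is a geodesic with `γ 0 = x` and `γ' 0 = v`. -/
def IsGeodesicFrom (x : M) (v : TangentSpace 𝓘(ℝ, E) x) (γ : ℝ → M) : Prop :=
  IsGeodesic (E := E) γ ∧
    (⟨γ 0, velocity γ 0⟩ : TangentBundle 𝓘(ℝ, E) M) = ⟨x, v⟩

variable (E M) in
/-- (Geodesic) completeness: the exponential map is defined on the whole tangent bundle. -/
def GeodesicallyComplete : Prop :=
  ∀ (x : M) (v : TangentSpace 𝓘(ℝ, E) x), ∃ γ : ℝ → M, IsGeodesicFrom x v γ

open Classical in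
/-- The geodesic `t ↦ Exp_x (t v)` (a constant curve if there is none). -/
def geodesic (x : M) (v : TangentSpace 𝓘(ℝ, E) x) : ℝ → M :=
  if h : ∃ γ : ℝ → M, IsGeodesicFrom x v γ then h.choose else fun _ ↦ x

/-- The Riemannian exponential map. -/
def Exp (x : M) (v : TangentSpace 𝓘(ℝ, E) x) : M := geodesic x v 1

open Classical in
/-- Parallel transport along `γ` from time `s` to time `t`. -/
def transport (γ : ℝ → M) (s t : ℝ) (u : TangentSpace 𝓘(ℝ, E) (γ s)) :
    TangentSpace 𝓘(ℝ, E) (γ t) :=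
  if h : ∃ V : ∀ r, TangentSpace 𝓘(ℝ, E) (γ r), IsParallelAlong γ V ∧ V s = u
  then h.choose t else 0

open Classical in
/-- Parallel transport `T_x M → T_y M` along the geodesic `t ↦ Exp_x (t v)`, `0 ≤ t ≤ 1`, when
this geodesic leads from `x` to `y`. -/
def transportTo (x y : M) (v u : TangentSpace 𝓘(ℝ, E) x) : TangentSpace 𝓘(ℝ, E) y :=
  if h : geodesic x v 0 = x ∧ geodesic x v 1 = y then
    h.2 ▸ transport (geodesic x v) 0 1 (h.1.symm ▸ u)
  else 0

/-- `log x y` plays the role of `Exp_x⁻¹ y`: it is a shortest tangent vector at `x` that `Exp_x`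
sends to `y`, for every `y` that is reached by `Exp_x`. If `Exp_x` is injective this determines
`log x` on the range of `Exp_x`; in general it is a choice of a shortest geodesic from `x` to
`y`. -/
def IsInverseExp (log : ∀ x _ : M, TangentSpace 𝓘(ℝ, E) x) : Prop :=
  ∀ (x : M) (v : TangentSpace 𝓘(ℝ, E) x),
    Exp x (log x (Exp x v)) = Exp x v ∧ ‖log x (Exp x v)‖ ≤ ‖v‖

variable [FiniteDimensional ℝ E]

/-- The Riemannian gradient: `⟪grad f x, v⟫ = df_x(v)` for all `v`. -/
def grad (f : M → ℝ) (x : M) : TangentSpace 𝓘(ℝ, E) x :=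
  haveI : FiniteDimensional ℝ (TangentSpace 𝓘(ℝ, E) x) := inferInstanceAs (FiniteDimensional ℝ E)
  haveI : CompleteSpace (TangentSpace 𝓘(ℝ, E) x) := FiniteDimensional.complete ℝ _
  (InnerProductSpace.toDual ℝ (TangentSpace 𝓘(ℝ, E) x)).symm
    (mfderiv 𝓘(ℝ, E) 𝓘(ℝ, ℝ) f x : TangentSpace 𝓘(ℝ, E) x →L[ℝ] ℝ)

variable (E) in
/-- Geodesic `L`-smoothness: `f` is differentiable and its gradient is `L`-Lipschitz, that is
`‖g_x - Γ_y^x g_y‖ ≤ L ‖v‖` whenever a geodesic with initial velocity `v` leads from `x` (at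
time `0`) to `y` (at time `1`), with the parallel transport `Γ_y^x` along this geodesic. -/
def GeodesicallySmooth (L : ℝ) (f : M → ℝ) : Prop :=
  MDifferentiable 𝓘(ℝ, E) 𝓘(ℝ, ℝ) f ∧
    ∀ γ : ℝ → M, IsGeodesic (E := E) γ →
      ‖grad (E := E) f (γ 0) - transport γ 1 0 (grad (E := E) f (γ 1))‖
        ≤ L * ‖velocity (E := E) γ 0‖

end Geometry

section Sampling

/-- How a sample of the indices `1, …, n` is drawn. -/
inductive Sampling
  | withReplacement
  | withoutReplacement

open Classical in
/-- The equally likely lists of `n` indices whose first `S` entries are the sample of size `S`: all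
lists, or all lists without repetition. -/
def Sampling.draws (mode : Sampling) (n : ℕ) : Finset (Fin n → Fin n) :=
  match mode with
  | .withReplacement => Finset.univ
  | .withoutReplacement => Finset.univ.filter Function.Injective

/-- Average of `h` over the sample that consists of the first `S` entries of the list `b`; `n`
samples are the full batch. (The average over no sample is `0`.) -/
def batchMean {n : ℕ} {F : Type*} [AddCommGroup F] [Module ℝ F] (b : Fin n → Fin n) (S : ℕ)
    (h : Fin n → F) : F :=
  if n ≤ S then (n : ℝ)⁻¹ • ∑ i, h i
  else (S : ℝ)⁻¹ • ∑ j ∈ Finset.univ.filter (fun j : Fin n ↦ (j : ℕ) < S), h (b j)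

end Sampling

section Algorithm

variable {E : Type*} [NormedAddCommGroup E] [NormedSpace ℝ E] [FiniteDimensional ℝ E]
  {M : Type*} [TopologicalSpace M] [ChartedSpace E M] [IsManifold 𝓘(ℝ, E) ∞ M]
  [RiemannianBundle (fun x : M ↦ TangentSpace 𝓘(ℝ, E) x)]

/-- The inputs of the algorithm other than the starting point. -/
structure Params where
  /-- number of samples in the passes `t` with `q ∣ t` -/
  S₁ : ℕ
  /-- period of these passes -/
  q : ℕ
  /-- step size -/
  η : ℝ
  /-- smoothness constant -/
  L : ℝ
  /-- accuracy -/
  ε : ℝ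

variable (E M) in
/-- What the algorithm stores at the beginning of pass `t`. -/
structure State where
  /-- the pass counter `t` -/
  t : ℕ
  /-- the iterate `x_t` -/
  x : M
  /-- the pair `(x_{t-1}, v_{t-1})` of the previous pass (not used if `t = 0`) -/
  prev : TangentBundle 𝓘(ℝ, E) M
  /-- the number of IFO calls made so far -/
  calls : ℕ

/-- The state before pass `0`. -/
def State.init (x₀ : M) : State E M := ⟨0, x₀, ⟨x₀, 0⟩, 0⟩

variable {n : ℕ} (f : Fin n → M → ℝ) (log : ∀ x _ : M, TangentSpace 𝓘(ℝ, E) x) (P : Params)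

/-- The number of samples in a pass `t` with `q ∤ t`:
`⌈min {n, q L² ‖Exp⁻¹_{x_{t-1}} x_t‖² / (2 ε²)}⌉`. -/
def S₂ (n : ℕ) (s : State E M) : ℕ :=
  ⌈min (n : ℝ) (P.q * P.L ^ 2 * ‖log s.prev.1 s.x‖ ^ 2 / (2 * P.ε ^ 2))⌉₊

/-- The gradient estimator `v_t`, computed with the list of indices `b`. -/
def estimator (b : Fin n → Fin n) (s : State E M) : TangentSpace 𝓘(ℝ, E) s.x :=
  if s.t % P.q = 0 then
    batchMean b P.S₁ (fun i ↦ grad (f i) s.x)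
  else
    batchMean b (S₂ log P n s) (fun i ↦ grad (f i) s.x)
      - transportTo s.prev.1 s.x (log s.prev.1 s.x)
          (batchMean b (S₂ log P n s) (fun i ↦ grad (f i) s.prev.1) - s.prev.2)

/-- The number of IFO calls in a pass: one for each evaluation of a `∇f_i` at a point. -/
def passCalls (n : ℕ) (s : State E M) : ℕ :=
  if s.t % P.q = 0 then P.S₁ else 2 * S₂ log P n s

/-- One pass of the loop. -/
def pass (b : Fin n → Fin n) (s : State E M) : State E M where
  t := s.t + 1
  x := Exp s.x (-P.η • estimator f log P b s)
  prev := ⟨s.x, estimator f log P b s⟩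
  calls := s.calls + passCalls log P n s

/-- The state after `k` passes from `x₀`, if pass `t` uses the list of indices `b t`. -/
def run (x₀ : M) (b : ℕ → Fin n → Fin n) : ℕ → State E M
  | 0 => State.init x₀
  | k + 1 => pass f log P (b k) (run x₀ b k)

/-- The state after `k ≤ N` passes, when only the lists for the first `N` passes are given. -/
def runFin (x₀ : M) {N : ℕ} (o : Fin N → Fin n → Fin n) (k : ℕ) : State E M :=
  run f log P x₀ (fun t ↦ if h : t < N then o ⟨t, h⟩ else id) k

/-- The independent random lists for the passes `0, …, N - 1`, all equally likely. -/
def outcomes (mode : Sampling) (n N : ℕ) : Finset (Fin N → Fin n → Fin n) :=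
  Fintype.piFinset (fun _ ↦ mode.draws n)

/-- `E ‖∇F(x)‖²` for the output `x`, drawn uniformly from `{x_1, …, x_T}`, of the algorithm on the
components `f` of the objective `F`. -/
def expectedSqGradNorm (mode : Sampling) (x₀ : M) (T : ℕ) (F : M → ℝ) : ℝ :=
  Finset.expect (outcomes mode n T) fun o ↦
    Finset.expect (Finset.Icc 1 T) fun t ↦
      ‖grad (E := E) F (runFin f log P x₀ o t).x‖ ^ 2

/-- The expected number of IFO calls in the first `N` passes `t = 0, …, N - 1`. -/
def expectedCalls (mode : Sampling) (x₀ : M) (N : ℕ) : ℝ :=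
  Finset.expect (outcomes mode n N) fun o ↦ ((runFin f log P x₀ o N).calls : ℝ)

end Algorithm

end RSpider

end

/-!
The proof of the complexity bound separates geometry, sampling and bookkeeping.

*Geometry.* In a chart the equation of parallel fields along a smooth curve is a linear ordinary
differential equation, and it does not depend on the chart because the Christoffel symbols transform
with the second derivative of the transition map (`christoffel_transition`). So parallel fields
exist locally, are unique because inner products of parallel fields are constant
(`IsParallelOn.metric_eq`), and can be glued along the whole curve (`exists_isParallelOn_univ`).
Hence parallel transport is a linear isometry (`exists_transport_linearIsometry`). Comparing the
gradient along a geodesic with a parallel field gives the quadratic upper bound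
`f (Exp x v) ≤ f x + ⟪∇f x, v⟫ + L ‖v‖² / 2` (`GeodesicallySmooth.exp_le`) and
`‖∇f (Exp x v)‖ ≤ ‖∇f x‖ + L ‖v‖` (`GeodesicallySmooth.norm_grad_exp_le`).

*Sampling.* For both ways of sampling, different draws are not positively correlated
(`Sampling.sum_draws_inner_nonpos`), so that the average over `S` draws of a centred family has at
most `1 / S` times its variance. As transport is an isometry, the error `v_t - ∇f(x_t)` in a pass
with a random sample is the isometric image of the previous error plus a sampling error of mean
zero; the choice of the sample size bounds the variance of the latter by `2 ε² / q`
(`expect_estimatorError_pass_le`). The error vanishes in the full batch passes, so after pass `k`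
its mean square is at most `(k mod q) · 2 ε² / q`, which is less than `ε²` on average over `k`.

*Bookkeeping.* With step size `1 / (2 L)` the quadratic upper bound becomes
`‖∇f(x_t)‖² + ‖v_t‖² / 2 ≤ 4 L (f(x_t) - f(x_{t+1})) + ‖v_t - ∇f(x_t)‖²` (`objective_pass_le`).
Summed over the passes (`expect_totalProgress_le`) it bounds the gradients at the iterates and also
the `‖v_t‖²`. The latter bound the numbers of samples, as `‖Exp⁻¹ x_{t+1}‖ ≤ ‖v_t‖ / (2 L)` because
`Exp⁻¹` is a shortest preimage (`passCalls_le`). The period `q = ⌈√n⌉` balances the cost of the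
full batches against that of the random samples (`expectedCalls_lt`).
-/

noncomputable section

open Set Filter Topology

set_option linter.unusedSectionVars false
-- the value that Mathlib itself is compiled with
set_option maxSynthPendingDepth 3

namespace RSpider

/-! ### Calculus in coordinates -/

section

theorem continuousAt_flip {F₁ F₂ F₃ : Type*} [NormedAddCommGroup F₁] [NormedSpace ℝ F₁]
    [NormedAddCommGroup F₂] [NormedSpace ℝ F₂] [NormedAddCommGroup F₃] [NormedSpace ℝ F₃]
    {A : ℝ → F₁ →L[ℝ] F₂ →L[ℝ] F₃} {s : ℝ} (h : ContinuousAt A s) :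
    ContinuousAt (fun s ↦ (A s).flip) s :=
  ((ContinuousLinearMap.flipₗᵢ ℝ F₁ F₂ F₃).continuous.continuousAt).comp h

theorem continuousAt_inverse {F₁ F₂ : Type*} [NormedAddCommGroup F₁] [NormedSpace ℝ F₁]
    [CompleteSpace F₁] [NormedAddCommGroup F₂] [NormedSpace ℝ F₂] {A : ℝ → F₁ →L[ℝ] F₂} {s : ℝ}
    (h : ContinuousAt A s) (e : F₁ ≃L[ℝ] F₂) (he : (e : F₁ →L[ℝ] F₂) = A s) :
    ContinuousAt (fun s ↦ (A s).inverse) s := by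
  have h3 : ContinuousAt ContinuousLinearMap.inverse (A s) := by
    rw [← he]
    exact (contDiffAt_map_inverse (𝕜 := ℝ) (n := 0) e).continuousAt
  exact ContinuousAt.comp (f := A) h3 h

section Coordinates

variable {E E' : Type*} [NormedAddCommGroup E] [NormedSpace ℝ E]
  [NormedAddCommGroup E'] [NormedSpace ℝ E']

theorem fderiv_pullback_bilin {G : E' → E' →L[ℝ] E' →L[ℝ] ℝ} {φ : E → E'} {p : E}
    (hG : DifferentiableAt ℝ G (φ p)) (hφ : DifferentiableAt ℝ φ p)
    (hφ' : DifferentiableAt ℝ (fderiv ℝ φ) p) (u v w : E) :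
    fderiv ℝ (fun p' => G (φ p') (fderiv ℝ φ p' v) (fderiv ℝ φ p' w)) p u =
      fderiv ℝ G (φ p) (fderiv ℝ φ p u) (fderiv ℝ φ p v) (fderiv ℝ φ p w)
      + G (φ p) (fderiv ℝ (fderiv ℝ φ) p u v) (fderiv ℝ φ p w)
      + G (φ p) (fderiv ℝ φ p v) (fderiv ℝ (fderiv ℝ φ) p u w) := by
  have h1 := HasFDerivAt.comp (g := G) (f := φ) p hG.hasFDerivAt hφ.hasFDerivAt
  have h2 (v : E) : HasFDerivAt (fun p' => fderiv ℝ φ p' v) _ p :=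
    hφ'.hasFDerivAt.clm_apply (hasFDerivAt_const v p)
  have h3 := (h1.clm_apply (h2 v)).clm_apply (h2 w)
  refine (congrArg (fun A : E →L[ℝ] ℝ => A u) h3.fderiv).trans ?_
  simp
  ring

theorem hasDerivAt_bilin {G : E → E →L[ℝ] E →L[ℝ] ℝ} {c a b : ℝ → E} {c' a' b' : E} {t : ℝ}
    (hG : DifferentiableAt ℝ G (c t)) (hc : HasDerivAt c c' t) (ha : HasDerivAt a a' t)
    (hb : HasDerivAt b b' t) :
    HasDerivAt (fun s ↦ G (c s) (a s) (b s))
      (fderiv ℝ G (c t) c' (a t) (b t) + G (c t) a' (b t) + G (c t) (a t) b') t := by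
  have h1 := HasFDerivAt.comp_hasDerivAt (l := G) (f := c) t hG.hasFDerivAt hc
  have h2 := HasDerivAt.clm_apply h1 ha
  have h3 := HasDerivAt.clm_apply h2 hb
  refine HasDerivAt.congr_deriv h3 ?_
  simp only [add_apply, Function.comp_apply]

/-- The Christoffel symbols of the first kind of the metric `G` at `p` in the direction `u`, as a
continuous bilinear form. -/
def christoffelForm (G : E → E →L[ℝ] E →L[ℝ] ℝ) (p u : E) : E →L[ℝ] E →L[ℝ] ℝ :=
  (1 / 2 : ℝ) • (fderiv ℝ G p u + (fderiv ℝ G p).flip u - ((fderiv ℝ G p).flip u).flip)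

theorem christoffelForm_eq (G : E → E →L[ℝ] E →L[ℝ] ℝ) (p u v w : E) :
    christoffelForm G p u v w =
      (fderiv ℝ G p u v w + fderiv ℝ G p v u w - fderiv ℝ G p w u v) / 2 := by
  simp [christoffelForm]
  ring

/-- The Christoffel symbols of the second kind of the metric `G` at `p` in the direction `u`, with
a minus sign: the components `a` of a parallel field along a curve `c` satisfy
`a' = parallelCoeff G c c' a`. (The inverse is `0`, and the definition not meaningful, where `G` is
degenerate.) -/
def parallelCoeff (G : E → E →L[ℝ] E →L[ℝ] ℝ) (p u : E) : E →L[ℝ] E :=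
  -((G p).inverse ∘L christoffelForm G p u)

/-- On an interval that is short compared to the bound `K` of the coefficients, a linear
differential equation has a solution with any initial value at any time. -/
theorem exists_hasDerivAt_linear {E : Type*} [NormedAddCommGroup E] [NormedSpace ℝ E]
    [CompleteSpace E] {B : ℝ → E →L[ℝ] E} {a b K : ℝ} (hB : ContinuousOn B (Icc a b))
    (hK : ∀ t ∈ Icc a b, ‖B t‖ ≤ K) (hab : K * (b - a) ≤ 1 / 2) {t₀ : ℝ} (ht₀ : t₀ ∈ Icc a b)
    (u : E) : ∃ α : ℝ → E, α t₀ = u ∧ ∀ t ∈ Ioo a b, HasDerivAt α (B t (α t)) t := by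
  have hK0 : 0 ≤ K := (norm_nonneg _).trans (hK t₀ ht₀)
  have hpl : IsPicardLindelof (fun t x ↦ B t x) (⟨t₀, ht₀⟩ : Icc a b) u (‖u‖₊ + 1) 0
      (K.toNNReal * (2 * ‖u‖₊ + 1)) K.toNNReal := by
    refine ⟨fun t ht ↦ ?_, fun x _ ↦ hB.clm_apply continuousOn_const, fun t ht x hx ↦ ?_, ?_⟩
    · refine ((B t).lipschitz.weaken ?_).lipschitzOnWith
      rw [← NNReal.coe_le_coe, Real.coe_toNNReal _ hK0]
      exact hK t ht
    · refine ((B t).le_opNorm x).trans ?_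
      push_cast
      rw [Real.coe_toNNReal _ hK0]
      refine mul_le_mul (hK t ht) ?_ (norm_nonneg _) hK0
      have h1 : ‖x - u‖ ≤ ‖u‖ + 1 := by simpa [dist_eq_norm] using hx
      have h2 : ‖x‖ ≤ ‖x - u‖ + ‖u‖ := by simpa using norm_add_le (x - u) u
      linarith
    · push_cast
      rw [Real.coe_toNNReal _ hK0]
      have h1 : max (b - t₀) (t₀ - a) ≤ b - a := max_le (by linarith [ht₀.1]) (by linarith [ht₀.2])
      have h2 : K * max (b - t₀) (t₀ - a) ≤ 1 / 2 := (mul_le_mul_of_nonneg_left h1 hK0).trans hab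
      have := norm_nonneg u
      nlinarith
  obtain ⟨α, h0, h⟩ := hpl.exists_eq_forall_mem_Icc_hasDerivWithinAt₀
  exact ⟨α, h0, fun t ht ↦ (h t (Ioo_subset_Icc_self ht)).hasDerivAt (Icc_mem_nhds ht.1 ht.2)⟩

/-- A nondegenerate bilinear form on a finite-dimensional space, as an equivalence with the dual. -/
theorem exists_equiv_of_nondegenerate {E : Type*} [NormedAddCommGroup E] [NormedSpace ℝ E]
    [FiniteDimensional ℝ E] (G : E →L[ℝ] E →L[ℝ] ℝ) (hG : ∀ u, G u u = 0 → u = 0) :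
    ∃ e : E ≃L[ℝ] (E →L[ℝ] ℝ), (e : E →L[ℝ] E →L[ℝ] ℝ) = G := by
  have hinj : Function.Injective (G : E →ₗ[ℝ] E →L[ℝ] ℝ) := by
    rw [← LinearMap.ker_eq_bot, LinearMap.ker_eq_bot']
    intro u hu
    refine hG u ?_
    have : G u = 0 := hu
    rw [this]; rfl
  have hdim : Module.finrank ℝ E = Module.finrank ℝ (E →L[ℝ] ℝ) := by
    rw [← (LinearMap.toContinuousLinearMap (𝕜 := ℝ) (E := E) (F' := ℝ)).finrank_eq]
    exact (Subspace.dual_finrank_eq (K := ℝ) (V := E)).symm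
  refine ⟨(LinearEquiv.ofInjectiveOfFinrankEq (G : E →ₗ[ℝ] E →L[ℝ] ℝ) hinj
    hdim).toContinuousLinearEquiv, ?_⟩
  ext u w
  rfl

theorem apply_parallelCoeff [FiniteDimensional ℝ E] {G : E → E →L[ℝ] E →L[ℝ] ℝ} {p : E}
    (hG : ∀ u, G p u u = 0 → u = 0) (u v w : E) :
    G p (parallelCoeff G p u v) w = -christoffelForm G p u v w := by
  obtain ⟨e, he⟩ := exists_equiv_of_nondegenerate _ hG
  rw [parallelCoeff, ← he, ContinuousLinearMap.inverse_equiv]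
  simp

theorem continuousAt_parallelCoeff [FiniteDimensional ℝ E] {G : E → E →L[ℝ] E →L[ℝ] ℝ}
    {c c' : ℝ → E} {s : ℝ} (hGs : ContDiffAt ℝ ∞ G (c s)) (hG : ∀ u, G (c s) u u = 0 → u = 0)
    (hc : ContinuousAt c s) (hc' : ContinuousAt c' s) :
    ContinuousAt (fun s ↦ parallelCoeff G (c s) (c' s)) s := by
  have hG' : ContinuousAt (fderiv ℝ G) (c s) :=
    (hGs.fderiv_right (m := 0) (by norm_cast)).continuousAt
  obtain ⟨e, he⟩ := exists_equiv_of_nondegenerate _ hG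
  have h1 : ContinuousAt (fun s ↦ (G (c s)).inverse) s :=
    continuousAt_inverse (ContinuousAt.comp (f := c) hGs.continuousAt hc) e he
  have hD : ContinuousAt (fun s ↦ fderiv ℝ G (c s)) s := ContinuousAt.comp (f := c) hG' hc
  have hD1 : ContinuousAt (fun s ↦ fderiv ℝ G (c s) (c' s)) s := ContinuousAt.clm_apply hD hc'
  have hD2 : ContinuousAt (fun s ↦ (fderiv ℝ G (c s)).flip (c' s)) s :=
    ContinuousAt.clm_apply (continuousAt_flip hD) hc'
  have hD3 : ContinuousAt (fun s ↦ ((fderiv ℝ G (c s)).flip (c' s)).flip) s :=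
    continuousAt_flip hD2
  have h2 : ContinuousAt (fun s ↦ christoffelForm G (c s) (c' s)) s :=
    ContinuousAt.const_smul (ContinuousAt.sub (ContinuousAt.add hD1 hD2) hD3) (1 / 2 : ℝ)
  have h3 : ContinuousAt (fun s ↦ (G (c s)).inverse ∘L christoffelForm G (c s) (c' s)) s :=
    ContinuousAt.clm_comp h1 h2
  exact ContinuousAt.neg h3

end Coordinates

end

/-! ### Riemannian metric and Christoffel symbols in charts -/

section

variable {E : Type*} [NormedAddCommGroup E] [NormedSpace ℝ E]
  {M : Type*} [TopologicalSpace M] [ChartedSpace E M] [IsManifold 𝓘(ℝ, E) ∞ M]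
  [RiemannianBundle (fun x : M ↦ TangentSpace 𝓘(ℝ, E) x)]

/-- The metric at `x`, as a bilinear form on the model space `E`, to which `T_x M` is definitionally
equal. -/
def metricCLM (x : M) : E →L[ℝ] E →L[ℝ] ℝ := (innerSL ℝ (E := TangentSpace 𝓘(ℝ, E) x))

/-- The components, in the chart centred at `x₀`, of tangent vectors at `y`. -/
def dchart (x₀ y : M) : E →L[ℝ] E := mfderiv 𝓘(ℝ, E) 𝓘(ℝ, E) (extChartAt 𝓘(ℝ, E) x₀) y

/-- The tangent vectors at the point with coordinates `p` in the chart centred at `x₀`, in terms of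
their components. -/
def dchartSymm (x₀ : M) (p : E) : E →L[ℝ] E :=
  mfderiv 𝓘(ℝ, E) 𝓘(ℝ, E) (extChartAt 𝓘(ℝ, E) x₀).symm p

/-- `chartMetric` as a function with values in the continuous bilinear forms. -/
def chartMetricCLM (x₀ : M) (p : E) : E →L[ℝ] E →L[ℝ] ℝ :=
  (metricCLM ((extChartAt 𝓘(ℝ, E) x₀).symm p)).bilinearComp (dchartSymm x₀ p) (dchartSymm x₀ p)

theorem chartMetricCLM_apply (x₀ : M) (p u w : E) :
    chartMetricCLM x₀ p u w = chartMetric x₀ p u w := rfl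

theorem chartMetric_eq (x₀ : M) (p u w : E) : chartMetric x₀ p u w =
    metricCLM ((extChartAt 𝓘(ℝ, E) x₀).symm p) (dchartSymm x₀ p u) (dchartSymm x₀ p w) := rfl

theorem dchart_comp (x₀ : M) (p : E) (hp : p ∈ (extChartAt 𝓘(ℝ, E) x₀).target) (u : E) :
    dchart x₀ ((extChartAt 𝓘(ℝ, E) x₀).symm p) (dchartSymm x₀ p u) = u := by
  have := mfderiv_extChartAt_comp_mfderivWithin_extChartAt_symm (I := 𝓘(ℝ, E)) hp
  simp only [modelWithCornersSelf_coe, range_id, mfderivWithin_univ] at this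
  exact congrArg (fun A => A u) this

theorem dchartSymm_comp (x₀ y : M) (hy : y ∈ (chartAt E x₀).source) (u : E) :
    dchartSymm x₀ (extChartAt 𝓘(ℝ, E) x₀ y) (dchart x₀ y u) = u := by
  have := mfderivWithin_extChartAt_symm_comp_mfderiv_extChartAt' (I := 𝓘(ℝ, E)) (x := x₀) (y := y)
    (by simpa using hy)
  simp only [modelWithCornersSelf_coe, range_id, mfderivWithin_univ] at this
  exact congrArg (fun A => A u) this

variable
  [IsContMDiffRiemannianBundle 𝓘(ℝ, E) ∞ E (fun x : M ↦ TangentSpace 𝓘(ℝ, E) x)]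

theorem contDiffOn_chartMetric (x₀ : M) (u w : E) :
    ContDiffOn ℝ ∞ (fun p => chartMetric x₀ p u w) (extChartAt 𝓘(ℝ, E) x₀).target := by
  have ho : IsOpen (extChartAt 𝓘(ℝ, E) x₀).target := isOpen_extChartAt_target x₀
  have h1 := (contMDiffOn_extChartAt_symm (I := 𝓘(ℝ, E)) (n := ∞) x₀).contMDiffOn_tangentMapWithin
    (m := ∞) le_rfl ho.uniqueMDiffOn
  -- constant components in the chart give a smooth vector field
  have key : ∀ u : E, ContMDiffOn 𝓘(ℝ, E) 𝓘(ℝ, E).tangent ∞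
      (fun p ↦ (⟨(extChartAt 𝓘(ℝ, E) x₀).symm p,
        mfderiv 𝓘(ℝ, E) 𝓘(ℝ, E) (extChartAt 𝓘(ℝ, E) x₀).symm p u⟩ : TangentBundle 𝓘(ℝ, E) M))
      (extChartAt 𝓘(ℝ, E) x₀).target := by
    intro u
    have h2 : ContMDiffOn 𝓘(ℝ, E) 𝓘(ℝ, E).tangent ∞
        (fun p : E ↦ (⟨p, u⟩ : TangentBundle 𝓘(ℝ, E) E)) (extChartAt 𝓘(ℝ, E) x₀).target := by
      intro p hp
      rw [contMDiffWithinAt_totalSpace]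
      refine ⟨contMDiffWithinAt_id, ?_⟩
      simpa using contMDiffWithinAt_const
    have h3 := h1.comp h2 (fun p hp => hp)
    refine h3.congr ?_
    intro p hp
    simp only [Function.comp, tangentMapWithin]
    rw [mfderivWithin_of_isOpen ho hp]
  have := ContMDiffOn.inner_bundle (IB := 𝓘(ℝ, E)) (F := E)
    (E := (fun x : M ↦ TangentSpace 𝓘(ℝ, E) x)) (key u) (key w)
  exact contMDiffOn_iff_contDiffOn.1 this

theorem contDiffOn_chartMetricCLM [FiniteDimensional ℝ E] (x₀ : M) :
    ContDiffOn ℝ ∞ (chartMetricCLM x₀) (extChartAt 𝓘(ℝ, E) x₀).target := by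
  rw [contDiffOn_clm_apply]
  intro u
  rw [contDiffOn_clm_apply]
  intro w
  exact contDiffOn_chartMetric x₀ u w

theorem metricCLM_symm (x : M) (u w : E) : metricCLM x u w = metricCLM x w u :=
  real_inner_comm (F := TangentSpace 𝓘(ℝ, E) x) w u

theorem metricCLM_self_eq_zero (x : M) (u : E) (h : metricCLM x u u = 0) : u = 0 :=
  (inner_self_eq_zero (𝕜 := ℝ) (E := TangentSpace 𝓘(ℝ, E) x) (x := u)).1 h

/-- The transition map between the charts centred at `x₁` and `x₀`. -/
def transition (x₁ x₀ : M) : E → E :=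
  fun p => extChartAt 𝓘(ℝ, E) x₀ ((extChartAt 𝓘(ℝ, E) x₁).symm p)

/-- The domain of `transition x₁ x₀`. -/
def transitionSource (x₁ x₀ : M) : Set E :=
  (extChartAt 𝓘(ℝ, E) x₁).target ∩ (extChartAt 𝓘(ℝ, E) x₁).symm ⁻¹' (chartAt E x₀).source

theorem isOpen_transitionSource (x₁ x₀ : M) : IsOpen (transitionSource (E := E) x₁ x₀) :=
  (continuousOn_extChartAt_symm x₁).isOpen_inter_preimage (isOpen_extChartAt_target x₁)
    (chartAt E x₀).open_source

theorem contDiffOn_transition (x₁ x₀ : M) :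
    ContDiffOn ℝ ∞ (transition (E := E) x₁ x₀) (transitionSource x₁ x₀) := by
  rw [← contMDiffOn_iff_contDiffOn]
  exact (contMDiffOn_extChartAt (I := 𝓘(ℝ, E)) (n := ∞) (x := x₀)).comp
    ((contMDiffOn_extChartAt_symm (I := 𝓘(ℝ, E)) (n := ∞) x₁).mono inter_subset_left)
    inter_subset_right

theorem fderiv_transition (x₁ x₀ : M) {p : E} (hp : p ∈ transitionSource x₁ x₀) (u : E) :
    fderiv ℝ (transition (E := E) x₁ x₀) p u =
      dchart x₀ ((extChartAt 𝓘(ℝ, E) x₁).symm p) (dchartSymm x₁ p u) := by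
  have h1 : MDifferentiableAt 𝓘(ℝ, E) 𝓘(ℝ, E) (extChartAt 𝓘(ℝ, E) x₁).symm p := by
    have := mdifferentiableWithinAt_extChartAt_symm (I := 𝓘(ℝ, E)) hp.1
    rwa [modelWithCornersSelf_coe, range_id, mdifferentiableWithinAt_univ] at this
  have h2 : MDifferentiableAt 𝓘(ℝ, E) 𝓘(ℝ, E) (extChartAt 𝓘(ℝ, E) x₀)
      ((extChartAt 𝓘(ℝ, E) x₁).symm p) :=
    mdifferentiableAt_extChartAt hp.2
  have := mfderiv_comp p h2 h1
  rw [mfderiv_eq_fderiv] at this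
  exact congrArg (fun A => A u) this

end

/-! ### Change of charts -/

section

variable {E : Type*} [NormedAddCommGroup E] [NormedSpace ℝ E]
  {M : Type*} [TopologicalSpace M] [ChartedSpace E M] [IsManifold 𝓘(ℝ, E) ∞ M]
  [RiemannianBundle (fun x : M ↦ TangentSpace 𝓘(ℝ, E) x)]
    [IsContMDiffRiemannianBundle 𝓘(ℝ, E) ∞ E (fun x : M ↦ TangentSpace 𝓘(ℝ, E) x)]

theorem chartMetric_symm (x₀ : M) (p u w : E) : chartMetric x₀ p u w = chartMetric x₀ p w u :=
  metricCLM_symm _ _ _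

theorem transition_mem_target {x₁ x₀ : M} {p : E} (hp : p ∈ transitionSource x₁ x₀) :
    transition x₁ x₀ p ∈ (extChartAt 𝓘(ℝ, E) x₀).target :=
  (extChartAt 𝓘(ℝ, E) x₀).map_source (by rw [extChartAt_source]; exact hp.2)

theorem extChartAt_symm_transition {x₁ x₀ : M} {p : E} (hp : p ∈ transitionSource x₁ x₀) :
    (extChartAt 𝓘(ℝ, E) x₀).symm (transition x₁ x₀ p) = (extChartAt 𝓘(ℝ, E) x₁).symm p :=
  (extChartAt 𝓘(ℝ, E) x₀).left_inv (by rw [extChartAt_source]; exact hp.2)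

theorem chartMetric_transition {x₁ x₀ : M} {p : E} (hp : p ∈ transitionSource x₁ x₀) (u w : E) :
    chartMetric x₁ p u w = chartMetric x₀ (transition x₁ x₀ p)
      (fderiv ℝ (transition x₁ x₀) p u) (fderiv ℝ (transition x₁ x₀) p w) := by
  rw [chartMetric_eq, chartMetric_eq, extChartAt_symm_transition hp]
  have (u : E) : dchartSymm x₀ (transition x₁ x₀ p) (fderiv ℝ (transition x₁ x₀) p u) =
      dchartSymm x₁ p u := by
    rw [fderiv_transition x₁ x₀ hp]
    exact dchartSymm_comp x₀ _ hp.2 _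
  rw [this, this]

variable [FiniteDimensional ℝ E]

theorem differentiableAt_chartMetricCLM {x₀ : M} {p : E}
    (hp : p ∈ (extChartAt 𝓘(ℝ, E) x₀).target) : DifferentiableAt ℝ (chartMetricCLM x₀) p :=
  ((contDiffOn_chartMetricCLM x₀).contDiffAt
    ((isOpen_extChartAt_target x₀).mem_nhds hp)).differentiableAt (by simp)

theorem fderiv_chartMetric {x₀ : M} {p : E}
    (hp : p ∈ (extChartAt 𝓘(ℝ, E) x₀).target) (u v w : E) :
    fderiv ℝ (fun p' ↦ chartMetric x₀ p' v w) p u = fderiv ℝ (chartMetricCLM x₀) p u v w := by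
  have h := ((differentiableAt_chartMetricCLM hp).hasFDerivAt.clm_apply
    (hasFDerivAt_const v p)).clm_apply (hasFDerivAt_const w p)
  have h' : HasFDerivAt (fun p' ↦ chartMetric x₀ p' v w) _ p := h
  rw [h'.fderiv]
  simp

theorem fderiv_chartMetric_transition {x₁ x₀ : M} {p : E} (hp : p ∈ transitionSource x₁ x₀)
    (u v w : E) :
    fderiv ℝ (fun p' ↦ chartMetric x₁ p' v w) p u =
      fderiv ℝ (fun p' ↦ chartMetric x₀ p' (fderiv ℝ (transition x₁ x₀) p v)
          (fderiv ℝ (transition x₁ x₀) p w)) (transition x₁ x₀ p) (fderiv ℝ (transition x₁ x₀) p u)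
      + chartMetric x₀ (transition x₁ x₀ p) (fderiv ℝ (fderiv ℝ (transition x₁ x₀)) p u v)
          (fderiv ℝ (transition x₁ x₀) p w)
      + chartMetric x₀ (transition x₁ x₀ p) (fderiv ℝ (transition x₁ x₀) p v)
          (fderiv ℝ (fderiv ℝ (transition x₁ x₀)) p u w) := by
  have hn := (isOpen_transitionSource x₁ x₀).mem_nhds hp
  have h0 : (fun p' ↦ chartMetric x₁ p' v w) =ᶠ[𝓝 p] fun p' ↦ chartMetricCLM x₀
      (transition x₁ x₀ p') (fderiv ℝ (transition x₁ x₀) p' v)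
      (fderiv ℝ (transition x₁ x₀) p' w) := by
    filter_upwards [hn] with p' hp'
    exact chartMetric_transition hp' v w
  have hφ := (contDiffOn_transition (E := E) x₁ x₀).contDiffAt hn
  rw [h0.fderiv_eq, fderiv_chartMetric (transition_mem_target hp)]
  exact fderiv_pullback_bilin (differentiableAt_chartMetricCLM (transition_mem_target hp))
    (hφ.differentiableAt (by simp))
    ((hφ.fderiv_right (m := 1) (by norm_cast)).differentiableAt (by simp)) u v w

/-- The Christoffel symbols are not a tensor: a change of chart adds the second derivative of the
transition map. -/
theorem christoffel_transition {x₁ x₀ : M} {p : E} (hp : p ∈ transitionSource x₁ x₀) (u v w : E) :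
    christoffel x₁ p u v w =
      christoffel x₀ (transition x₁ x₀ p) (fderiv ℝ (transition x₁ x₀) p u)
        (fderiv ℝ (transition x₁ x₀) p v) (fderiv ℝ (transition x₁ x₀) p w)
      + chartMetric x₀ (transition x₁ x₀ p) (fderiv ℝ (fderiv ℝ (transition x₁ x₀)) p u v)
          (fderiv ℝ (transition x₁ x₀) p w) := by
  have hφ := (contDiffOn_transition (E := E) x₁ x₀).contDiffAt
    ((isOpen_transitionSource x₁ x₀).mem_nhds hp)
  have hsymm : IsSymmSndFDerivAt ℝ (transition (E := E) x₁ x₀) p :=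
    hφ.isSymmSndFDerivAt (by simp only [minSmoothness_of_isRCLikeNormedField]; norm_cast)
  rw [christoffel, christoffel, fderiv_chartMetric_transition hp, fderiv_chartMetric_transition hp,
    fderiv_chartMetric_transition hp, hsymm.eq v u, hsymm.eq w u, hsymm.eq w v,
    chartMetric_symm x₀ _ (fderiv ℝ (transition x₁ x₀) p v),
    chartMetric_symm x₀ _ (fderiv ℝ (transition x₁ x₀) p u)]
  ring

/-- The defining property of the Levi-Civita connection that it preserves the metric. -/
theorem christoffel_add_christoffel {x₀ : M} (p u v w : E) :
    christoffel x₀ p u v w + christoffel x₀ p u w v =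
      fderiv ℝ (fun p' ↦ chartMetric x₀ p' v w) p u := by
  have h (a b : E) : (fun p' ↦ chartMetric x₀ p' a b) = fun p' ↦ chartMetric x₀ p' b a :=
    funext fun _ ↦ chartMetric_symm _ _ _ _
  rw [christoffel, christoffel, h w v]
  ring

theorem christoffel_eq {x₀ : M} {p : E} (hp : p ∈ (extChartAt 𝓘(ℝ, E) x₀).target) (u v w : E) :
    christoffel x₀ p u v w = (fderiv ℝ (chartMetricCLM x₀) p u v w
      + fderiv ℝ (chartMetricCLM x₀) p v u w - fderiv ℝ (chartMetricCLM x₀) p w u v) / 2 := by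
  simp only [christoffel, fderiv_chartMetric hp]

end

/-! ### Parallel fields -/

section

variable {E : Type*} [NormedAddCommGroup E] [NormedSpace ℝ E]
  {M : Type*} [TopologicalSpace M] [ChartedSpace E M] [IsManifold 𝓘(ℝ, E) ∞ M]
  [RiemannianBundle (fun x : M ↦ TangentSpace 𝓘(ℝ, E) x)]
    [IsContMDiffRiemannianBundle 𝓘(ℝ, E) ∞ E (fun x : M ↦ TangentSpace 𝓘(ℝ, E) x)]

/-- The coordinates of the curve `γ` in the chart centred at `x₀`. -/
def coords (x₀ : M) (γ : ℝ → M) (s : ℝ) : E := extChartAt 𝓘(ℝ, E) x₀ (γ s)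

/-- The components of the vector field `V` along `γ` in the chart centred at `x₀`. -/
def components (x₀ : M) (γ : ℝ → M) (V : ℝ → E) (s : ℝ) : E := dchart x₀ (γ s) (V s)

/-- The equation of parallel fields in one chart, at one time. Vector fields along a curve are
written as functions to the model space `E`, to which every tangent space is definitionally
equal. -/
def ParallelInChart (x₀ : M) (γ : ℝ → M) (V : ℝ → E) (t : ℝ) : Prop :=
  DifferentiableAt ℝ (components x₀ γ V) t ∧
    ∀ w : E, chartMetric x₀ (coords x₀ γ t) (deriv (components x₀ γ V) t) w
      + christoffel x₀ (coords x₀ γ t) (deriv (coords x₀ γ) t) (components x₀ γ V t) w = 0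

/-- The vector field `V` along `γ` is parallel at the times in `s`. -/
def IsParallelOn (γ : ℝ → M) (V : ℝ → E) (s : Set ℝ) : Prop :=
  ∀ t ∈ s, ∀ x₀ : M, γ t ∈ (chartAt E x₀).source → ParallelInChart x₀ γ V t

theorem isParallelAlong_iff (γ : ℝ → M) (V : ℝ → E) :
    IsParallelAlong (E := E) γ V ↔ IsParallelOn γ V univ :=
  ⟨fun h t _ x₀ hx ↦ h t x₀ hx, fun h t x₀ hx ↦ h t (mem_univ t) x₀ hx⟩

theorem IsParallelOn.mono {γ : ℝ → M} {V : ℝ → E} {s s' : Set ℝ} (h : IsParallelOn γ V s)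
    (hs : s' ⊆ s) : IsParallelOn γ V s' := fun t ht ↦ h t (hs ht)

theorem ParallelInChart.congr {x₀ : M} {γ : ℝ → M} {V W : ℝ → E} {t : ℝ}
    (h : ParallelInChart x₀ γ V t) (hVW : W =ᶠ[𝓝 t] V) : ParallelInChart x₀ γ W t := by
  have h' : components x₀ γ W =ᶠ[𝓝 t] components x₀ γ V := by
    filter_upwards [hVW] with s hs
    simp only [components, hs]
  refine ⟨h.1.congr_of_eventuallyEq h', fun w ↦ ?_⟩
  rw [h'.deriv_eq, h'.eq_of_nhds]
  exact h.2 w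

theorem coords_mem_target {x₀ : M} {γ : ℝ → M} {t : ℝ} (ht : γ t ∈ (chartAt E x₀).source) :
    coords x₀ γ t ∈ (extChartAt 𝓘(ℝ, E) x₀).target :=
  (extChartAt 𝓘(ℝ, E) x₀).map_source (by rwa [extChartAt_source])

theorem symm_coords {x₀ : M} {γ : ℝ → M} {t : ℝ} (ht : γ t ∈ (chartAt E x₀).source) :
    (extChartAt 𝓘(ℝ, E) x₀).symm (coords x₀ γ t) = γ t :=
  (extChartAt 𝓘(ℝ, E) x₀).left_inv (by rwa [extChartAt_source])

theorem dchartSymm_components {x₀ : M} {γ : ℝ → M} {t : ℝ} (ht : γ t ∈ (chartAt E x₀).source)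
    (V : ℝ → E) : dchartSymm x₀ (coords x₀ γ t) (components x₀ γ V t) = V t :=
  dchartSymm_comp x₀ _ ht _

theorem chartMetric_components {x₀ : M} {γ : ℝ → M} {t : ℝ} (ht : γ t ∈ (chartAt E x₀).source)
    (V W : ℝ → E) : chartMetric x₀ (coords x₀ γ t) (components x₀ γ V t) (components x₀ γ W t) =
      metricCLM (γ t) (V t) (W t) := by
  rw [chartMetric_eq, dchartSymm_components ht, dchartSymm_components ht, symm_coords ht]

theorem coords_mem_transitionSource {x₁ x₀ : M} {γ : ℝ → M} {t : ℝ}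
    (h₁ : γ t ∈ (chartAt E x₁).source) (h₀ : γ t ∈ (chartAt E x₀).source) :
    (coords x₁ γ t : E) ∈ transitionSource x₁ x₀ :=
  ⟨coords_mem_target h₁, by rw [mem_preimage, symm_coords h₁]; exact h₀⟩

theorem transition_coords {x₁ x₀ : M} {γ : ℝ → M} {t : ℝ}
    (h₁ : γ t ∈ (chartAt E x₁).source) :
    transition x₁ x₀ (coords x₁ γ t : E) = coords x₀ γ t := by
  rw [transition, symm_coords h₁, coords]

theorem fderiv_transition_components {x₁ x₀ : M} {γ : ℝ → M} {t : ℝ}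
    (h₁ : γ t ∈ (chartAt E x₁).source) (h₀ : γ t ∈ (chartAt E x₀).source) (V : ℝ → E) :
    fderiv ℝ (transition x₁ x₀) (coords x₁ γ t) (components x₁ γ V t) = components x₀ γ V t := by
  rw [fderiv_transition x₁ x₀ (coords_mem_transitionSource h₁ h₀), dchartSymm_components h₁,
    symm_coords h₁, components]

theorem fderiv_transition_surjective {x₁ x₀ : M} {p : E} (hp : p ∈ transitionSource x₁ x₀)
    (w : E) : ∃ w', fderiv ℝ (transition x₁ x₀) p w' = w := by
  refine ⟨dchart x₁ ((extChartAt 𝓘(ℝ, E) x₁).symm p) (dchartSymm x₀ (transition x₁ x₀ p) w), ?_⟩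
  have h1 : (extChartAt 𝓘(ℝ, E) x₁).symm p ∈ (chartAt E x₁).source := by
    have := (extChartAt 𝓘(ℝ, E) x₁).map_target hp.1
    rwa [extChartAt_source] at this
  have h2 := dchartSymm_comp x₁ _ h1 (dchartSymm x₀ (transition x₁ x₀ p) w)
  rw [(extChartAt 𝓘(ℝ, E) x₁).right_inv hp.1] at h2
  have h3 := dchart_comp x₀ _ (transition_mem_target hp) w
  rw [extChartAt_symm_transition hp] at h3
  rw [fderiv_transition x₁ x₀ hp, h2, h3]

variable [FiniteDimensional ℝ E]

/-- The equation of parallel fields does not depend on the chart. -/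
theorem ParallelInChart.change_chart {x₁ x₀ : M} {γ : ℝ → M} {V : ℝ → E} {t : ℝ}
    (h : ParallelInChart x₁ γ V t) (hγ : ContinuousAt γ t)
    (hc : DifferentiableAt ℝ (coords x₁ γ : ℝ → E) t)
    (h₁ : γ t ∈ (chartAt E x₁).source) (h₀ : γ t ∈ (chartAt E x₀).source) :
    ParallelInChart x₀ γ V t := by
  have hp := coords_mem_transitionSource h₁ h₀
  set φ : E → E := transition x₁ x₀ with hφdef
  have hφ := (contDiffOn_transition (E := E) x₁ x₀).contDiffAt
    ((isOpen_transitionSource x₁ x₀).mem_nhds hp)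
  have hφ1 : DifferentiableAt ℝ φ (coords x₁ γ t) := hφ.differentiableAt (by simp)
  have hφ2 : DifferentiableAt ℝ (fderiv ℝ φ) (coords x₁ γ t) :=
    (hφ.fderiv_right (m := 1) (by norm_cast)).differentiableAt (by simp)
  have hn₁ : ∀ᶠ s in 𝓝 t, γ s ∈ (chartAt E x₁).source :=
    hγ.eventually ((chartAt E x₁).open_source.mem_nhds h₁)
  have hn₀ : ∀ᶠ s in 𝓝 t, γ s ∈ (chartAt E x₀).source :=
    hγ.eventually ((chartAt E x₀).open_source.mem_nhds h₀)
  have ec : coords x₀ γ =ᶠ[𝓝 t] fun s ↦ φ (coords x₁ γ s) := by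
    filter_upwards [hn₁] with s hs using (transition_coords hs).symm
  have ea : components x₀ γ V =ᶠ[𝓝 t] fun s ↦ fderiv ℝ φ (coords x₁ γ s) (components x₁ γ V s) := by
    filter_upwards [hn₁, hn₀] with s hs hs' using (fderiv_transition_components hs hs' V).symm
  have dc : HasDerivAt (coords x₀ γ) (fderiv ℝ φ (coords x₁ γ t) (deriv (coords x₁ γ) t)) t :=
    (hφ1.hasFDerivAt.comp_hasDerivAt t hc.hasDerivAt).congr_of_eventuallyEq ec
  have da : HasDerivAt (components x₀ γ V)
      (fderiv ℝ (fderiv ℝ φ) (coords x₁ γ t) (deriv (coords x₁ γ) t) (components x₁ γ V t)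
        + fderiv ℝ φ (coords x₁ γ t) (deriv (components x₁ γ V) t)) t :=
    ((hφ2.hasFDerivAt.comp_hasDerivAt t hc.hasDerivAt).clm_apply
      h.1.hasDerivAt).congr_of_eventuallyEq ea
  refine ⟨da.differentiableAt, fun w ↦ ?_⟩
  obtain ⟨w', rfl⟩ := fderiv_transition_surjective hp w
  have key := h.2 w'
  rw [chartMetric_transition hp, christoffel_transition hp] at key
  rw [da.deriv, dc.deriv, ← transition_coords (x₀ := x₀) h₁,
    ← fderiv_transition_components h₁ h₀ V, ← chartMetricCLM_apply, map_add,
    add_apply, chartMetricCLM_apply, chartMetricCLM_apply]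
  linarith

/-- The inner product of parallel fields has derivative zero. -/
theorem ParallelInChart.hasDerivAt_metric {x₀ : M} {γ : ℝ → M} {V W : ℝ → E} {t : ℝ}
    (hV : ParallelInChart x₀ γ V t) (hW : ParallelInChart x₀ γ W t) (hγ : ContinuousAt γ t)
    (hc : DifferentiableAt ℝ (coords x₀ γ : ℝ → E) t) (h₀ : γ t ∈ (chartAt E x₀).source) :
    HasDerivAt (fun s ↦ metricCLM (γ s) (V s) (W s)) 0 t := by
  have hn₀ : ∀ᶠ s in 𝓝 t, γ s ∈ (chartAt E x₀).source :=
    hγ.eventually ((chartAt E x₀).open_source.mem_nhds h₀)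
  have e : (fun s ↦ metricCLM (γ s) (V s) (W s)) =ᶠ[𝓝 t] fun s ↦
      chartMetricCLM x₀ (coords x₀ γ s) (components x₀ γ V s) (components x₀ γ W s) := by
    filter_upwards [hn₀] with s hs using (chartMetric_components hs V W).symm
  have h := hasDerivAt_bilin (differentiableAt_chartMetricCLM (coords_mem_target h₀))
    hc.hasDerivAt hV.1.hasDerivAt hW.1.hasDerivAt
  refine (h.congr_of_eventuallyEq e).congr_deriv ?_
  have h1 := hV.2 (components x₀ γ W t)
  have h2 := hW.2 (components x₀ γ V t)
  have h3 := christoffel_add_christoffel (x₀ := x₀) (coords x₀ γ t) (deriv (coords x₀ γ) t)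
    (components x₀ γ V t) (components x₀ γ W t)
  rw [fderiv_chartMetric (coords_mem_target h₀)] at h3
  rw [chartMetric_symm] at h2
  simp only [chartMetricCLM_apply]
  linarith

theorem christoffelForm_apply {x₀ : M} {p : E} (hp : p ∈ (extChartAt 𝓘(ℝ, E) x₀).target)
    (u v w : E) : christoffelForm (chartMetricCLM x₀) p u v w = christoffel x₀ p u v w := by
  rw [christoffel_eq hp, christoffelForm_eq]

theorem ParallelInChart.smul_add {x₀ : M} {γ : ℝ → M} {V W : ℝ → E} {t : ℝ}
    (hV : ParallelInChart x₀ γ V t) (hW : ParallelInChart x₀ γ W t)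
    (h₀ : γ t ∈ (chartAt E x₀).source) (r : ℝ) :
    ParallelInChart x₀ γ (fun s ↦ r • V s + W s) t := by
  have e : components x₀ γ (fun s ↦ r • V s + W s) =
      r • components x₀ γ V + components x₀ γ W := by
    ext s; simp [components]
  have d := (hV.1.hasDerivAt.const_smul r).add hW.1.hasDerivAt
  refine ⟨e ▸ d.differentiableAt, fun w ↦ ?_⟩
  have h1 := hV.2 w
  have h2 := hW.2 w
  rw [e, d.deriv, ← chartMetricCLM_apply, ← christoffelForm_apply (coords_mem_target h₀)]
  rw [← chartMetricCLM_apply, ← christoffelForm_apply (coords_mem_target h₀)] at h1 h2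
  simp only [map_add, map_smul, Pi.add_apply, Pi.smul_apply, add_apply,
    smul_apply, smul_eq_mul]
  linear_combination r * h1 + h2

theorem IsParallelOn.smul_add {γ : ℝ → M} {V W : ℝ → E} {s : Set ℝ}
    (hV : IsParallelOn γ V s) (hW : IsParallelOn γ W s) (r : ℝ) :
    IsParallelOn γ (fun s ↦ r • V s + W s) s :=
  fun t ht x₀ h₀ ↦ ParallelInChart.smul_add (hV t ht x₀ h₀) (hW t ht x₀ h₀) h₀ r

/-- The coordinates of a smooth curve are smooth. -/
theorem contDiffAt_coords {γ : ℝ → M} (hγ : ContMDiff 𝓘(ℝ, ℝ) 𝓘(ℝ, E) ∞ γ) {x₀ : M} {t : ℝ}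
    (h₀ : γ t ∈ (chartAt E x₀).source) : ContDiffAt ℝ ∞ (coords x₀ γ : ℝ → E) t := by
  rw [← contMDiffAt_iff_contDiffAt]
  exact ContMDiffAt.comp t (contMDiffAt_extChartAt' h₀) (hγ t)

theorem IsParallelOn.metric_eq {γ : ℝ → M} (hγ : ContMDiff 𝓘(ℝ, ℝ) 𝓘(ℝ, E) ∞ γ) {V W : ℝ → E}
    {s : Set ℝ} (hs : IsOpen s) (hs' : IsPreconnected s) (hV : IsParallelOn γ V s)
    (hW : IsParallelOn γ W s) {t t' : ℝ} (ht : t ∈ s) (ht' : t' ∈ s) :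
    metricCLM (γ t) (V t) (W t) = metricCLM (γ t') (V t') (W t') := by
  have hd : ∀ r ∈ s, HasDerivAt (fun s ↦ metricCLM (γ s) (V s) (W s)) 0 r := fun r hr ↦
    ParallelInChart.hasDerivAt_metric (hV r hr _ (mem_chart_source E (γ r)))
      (hW r hr _ (mem_chart_source E (γ r)))
      hγ.continuous.continuousAt
      ((contDiffAt_coords hγ (mem_chart_source E (γ r))).differentiableAt (by simp))
      (mem_chart_source E (γ r))
  exact hs.is_const_of_deriv_eq_zero hs'
    (fun r hr ↦ (hd r hr).differentiableAt.differentiableWithinAt) (fun r hr ↦ (hd r hr).deriv)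
    ht ht'

/-- Parallel fields that agree at one time are equal, since their difference has constant norm. -/
theorem IsParallelOn.eqOn {γ : ℝ → M} (hγ : ContMDiff 𝓘(ℝ, ℝ) 𝓘(ℝ, E) ∞ γ) {V W : ℝ → E}
    {s : Set ℝ} (hs : IsOpen s) (hs' : IsPreconnected s) (hV : IsParallelOn γ V s)
    (hW : IsParallelOn γ W s) {t : ℝ} (ht : t ∈ s) (h : V t = W t) : EqOn V W s := by
  intro t' ht'
  have hd := hV.smul_add hW (-1)
  have hd' : IsParallelOn γ (fun r ↦ (-1 : ℝ) • V r + W r) s := hd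
  have := hd'.metric_eq hγ hs hs' hd' ht' ht
  simp only [h] at this
  have h0 : (-1 : ℝ) • V t' + W t' = 0 := by
    apply metricCLM_self_eq_zero (γ t')
    rw [this]
    simp
  have : W t' - V t' = 0 := by rw [← h0]; simp [sub_eq_add_neg, add_comm]
  exact (sub_eq_zero.1 this).symm

end

/-! ### Local existence of parallel fields -/

section

variable {E : Type*} [NormedAddCommGroup E] [NormedSpace ℝ E]
  {M : Type*} [TopologicalSpace M] [ChartedSpace E M] [IsManifold 𝓘(ℝ, E) ∞ M]
  [RiemannianBundle (fun x : M ↦ TangentSpace 𝓘(ℝ, E) x)]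
    [IsContMDiffRiemannianBundle 𝓘(ℝ, E) ∞ E (fun x : M ↦ TangentSpace 𝓘(ℝ, E) x)]
  [FiniteDimensional ℝ E]

theorem chartMetricCLM_nondegenerate {x₀ : M} {p : E}
    (hp : p ∈ (extChartAt 𝓘(ℝ, E) x₀).target) (u : E) (hu : chartMetricCLM x₀ p u u = 0) :
    u = 0 := by
  rw [chartMetricCLM_apply, chartMetric_eq] at hu
  have h := metricCLM_self_eq_zero _ _ hu
  rw [← dchart_comp x₀ p hp u, h, map_zero]

theorem continuousAt_parallelCoeff_chart {γ : ℝ → M} (hγ : ContMDiff 𝓘(ℝ, ℝ) 𝓘(ℝ, E) ∞ γ)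
    {x₀ : M} {s : ℝ} (h₀ : γ s ∈ (chartAt E x₀).source) :
    ContinuousAt (fun s ↦ parallelCoeff (chartMetricCLM x₀) (coords x₀ γ s : E)
      (deriv (coords x₀ γ) s)) s := by
  have hc : ContDiffAt ℝ ∞ (coords x₀ γ : ℝ → E) s := contDiffAt_coords hγ h₀
  have hc' : ContinuousAt (deriv (coords x₀ γ : ℝ → E)) s :=
    (ContDiffAt.derivWithin (m := 0) hc (by norm_cast)).continuousAt
  exact continuousAt_parallelCoeff ((contDiffOn_chartMetricCLM x₀).contDiffAt
    ((isOpen_extChartAt_target (I := 𝓘(ℝ, E)) x₀).mem_nhds (coords_mem_target h₀)))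
    (chartMetricCLM_nondegenerate (coords_mem_target h₀)) hc.continuousAt hc'

/-- Parallel fields exist locally. -/
theorem exists_isParallelOn_nhds {γ : ℝ → M} (hγ : ContMDiff 𝓘(ℝ, ℝ) 𝓘(ℝ, E) ∞ γ) (t : ℝ) :
    ∃ δ > 0, ∀ t₀ ∈ Ioo (t - δ) (t + δ), ∀ u : E, ∃ V : ℝ → E, V t₀ = u ∧
      IsParallelOn γ V (Ioo (t - δ) (t + δ)) := by
  have h₀ := mem_chart_source E (γ t)
  set A : ℝ → E →L[ℝ] E := fun s ↦ parallelCoeff (chartMetricCLM (γ t)) (coords (γ t) γ s)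
      (deriv (coords (γ t) γ) s) with hA
  have hev : ∀ᶠ s in 𝓝 t, γ s ∈ (chartAt E (γ t)).source ∧ ‖A s‖ < ‖A t‖ + 1 :=
    (hγ.continuous.continuousAt.eventually ((chartAt E (γ t)).open_source.mem_nhds h₀)).and
      ((continuousAt_parallelCoeff_chart hγ h₀).norm.eventually_lt continuousAt_const
        (lt_add_one _))
  obtain ⟨r, hr, hball⟩ := Metric.eventually_nhds_iff_ball.1 hev
  have hK : 0 < ‖A t‖ + 1 := by positivity
  -- on the interval of radius `δ` the curve stays in the chart and the solution exists throughout
  set δ := min (r / 2) (1 / (4 * (‖A t‖ + 1))) with hδ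
  have hδ0 : 0 < δ := by positivity
  have hmem : ∀ s ∈ Icc (t - δ) (t + δ), γ s ∈ (chartAt E (γ t)).source ∧ ‖A s‖ < ‖A t‖ + 1 := by
    intro s hs
    apply hball
    have : δ ≤ r / 2 := min_le_left _ _
    rw [Real.ball_eq_Ioo]
    exact ⟨by linarith [hs.1], by linarith [hs.2]⟩
  refine ⟨δ, hδ0, fun t₀ ht₀ u ↦ ?_⟩
  have hδ' : (‖A t‖ + 1) * ((t + δ) - (t - δ)) ≤ 1 / 2 := by
    have h1 : δ ≤ 1 / (4 * (‖A t‖ + 1)) := min_le_right _ _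
    rw [le_div_iff₀ (by positivity)] at h1
    linarith
  obtain ⟨α, hα0, hα⟩ := exists_hasDerivAt_linear
    (fun s hs ↦ (continuousAt_parallelCoeff_chart hγ (hmem s hs).1).continuousWithinAt)
    (fun s hs ↦ (hmem s hs).2.le) hδ' (Ioo_subset_Icc_self ht₀) (dchart (γ t) (γ t₀) u)
  have hmem' := fun s (hs : s ∈ Ioo (t - δ) (t + δ)) ↦ hmem s (Ioo_subset_Icc_self hs)
  refine ⟨fun s ↦ dchartSymm (γ t) (coords (γ t) γ s) (α s), ?_, fun s hs x₀ hx₀ ↦ ?_⟩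
  · simp only [hα0]
    exact dchartSymm_comp _ _ (hmem' t₀ ht₀).1 u
  · have e : components (γ t) γ (fun s ↦ dchartSymm (γ t) (coords (γ t) γ s) (α s)) =ᶠ[𝓝 s] α := by
      filter_upwards [Ioo_mem_nhds hs.1 hs.2] with s' hs'
      have := dchart_comp (γ t) (coords (γ t) γ s') (coords_mem_target (hmem' s' hs').1) (α s')
      rwa [symm_coords (hmem' s' hs').1] at this
    have h : ParallelInChart (γ t) γ (fun s ↦ dchartSymm (γ t) (coords (γ t) γ s) (α s)) s := by
      refine ⟨(hα s hs).differentiableAt.congr_of_eventuallyEq e, fun w ↦ ?_⟩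
      rw [e.deriv_eq, e.eq_of_nhds, (hα s hs).deriv, ← chartMetricCLM_apply,
        apply_parallelCoeff (chartMetricCLM_nondegenerate (coords_mem_target (hmem' s hs).1)),
        christoffelForm_apply (coords_mem_target (hmem' s hs).1)]
      ring
    exact h.change_chart hγ.continuous.continuousAt
      ((contDiffAt_coords hγ (hmem' s hs).1).differentiableAt (by simp)) (hmem' s hs).1 hx₀

end

/-! ### Gluing of parallel fields -/

section

variable {E : Type*} [NormedAddCommGroup E] [NormedSpace ℝ E]
  {M : Type*} [TopologicalSpace M] [ChartedSpace E M] [IsManifold 𝓘(ℝ, E) ∞ M]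
  [RiemannianBundle (fun x : M ↦ TangentSpace 𝓘(ℝ, E) x)]
    [IsContMDiffRiemannianBundle 𝓘(ℝ, E) ∞ E (fun x : M ↦ TangentSpace 𝓘(ℝ, E) x)]
  [FiniteDimensional ℝ E]

variable (E) in
/-- Every tangent vector at a point `γ t₀`, `a < t₀ < b`, extends to a parallel field along `γ` on
the interval `(a, b)`. -/
def ParallelExists (γ : ℝ → M) (a b : ℝ) : Prop :=
  ∀ t₀ ∈ Ioo a b, ∀ u : E, ∃ V : ℝ → E, V t₀ = u ∧ IsParallelOn γ V (Ioo a b)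

theorem ParallelExists.mono {γ : ℝ → M} {a b c d : ℝ} (h : ParallelExists E γ a b) (hac : a ≤ c)
    (hdb : d ≤ b) : ParallelExists E γ c d := fun t₀ ht₀ u ↦ by
  obtain ⟨V, hV, hV'⟩ := h t₀ (Ioo_subset_Ioo hac hdb ht₀) u
  exact ⟨V, hV, hV'.mono (Ioo_subset_Ioo hac hdb)⟩

theorem IsParallelOn.glue {γ : ℝ → M} {V W : ℝ → E} {a b c d : ℝ} (hcb : c < b)
    (hV : IsParallelOn γ V (Ioo a b)) (hW : IsParallelOn γ W (Ioo c d))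
    (h : EqOn V W (Ioo c b)) :
    IsParallelOn γ (fun s ↦ if s < b then V s else W s) (Ioo a d) := by
  intro t ht x₀ hx₀
  by_cases htb : t < b
  · refine ParallelInChart.congr (hV t ⟨ht.1, htb⟩ x₀ hx₀) ?_
    filter_upwards [Iio_mem_nhds htb] with s hs
    exact if_pos hs
  · refine ParallelInChart.congr (hW t ⟨by linarith, ht.2⟩ x₀ hx₀) ?_
    filter_upwards [Ioi_mem_nhds (show c < t by linarith)] with s hs
    by_cases hsb : s < b
    · exact (if_pos hsb).trans (h ⟨hs, hsb⟩)
    · exact if_neg hsb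

theorem ParallelExists.glue {γ : ℝ → M} (hγ : ContMDiff 𝓘(ℝ, ℝ) 𝓘(ℝ, E) ∞ γ) {a b c d : ℝ}
    (h₁ : ParallelExists E γ a b) (h₂ : ParallelExists E γ c d) (hac : a ≤ c) (hcb : c < b)
    (hbd : b ≤ d) : ParallelExists E γ a d := by
  intro t₀ ht₀ u
  obtain ⟨m, hm⟩ := exists_between hcb
  have agree : ∀ V W : ℝ → E, IsParallelOn γ V (Ioo a b) → IsParallelOn γ W (Ioo c d) →
      V m = W m → EqOn V W (Ioo c b) := fun V W hV hW h ↦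
    (hV.mono (Ioo_subset_Ioo hac le_rfl)).eqOn hγ isOpen_Ioo isPreconnected_Ioo
      (hW.mono (Ioo_subset_Ioo le_rfl hbd)) hm h
  by_cases htb : t₀ < b
  · obtain ⟨V, hV, hV'⟩ := h₁ t₀ ⟨ht₀.1, htb⟩ u
    obtain ⟨W, hW, hW'⟩ := h₂ m ⟨hm.1, hm.2.trans_le hbd⟩ (V m)
    exact ⟨_, (if_pos htb).trans hV, hV'.glue hcb hW' (agree V W hV' hW' hW.symm)⟩
  · obtain ⟨W, hW, hW'⟩ := h₂ t₀ ⟨by linarith, ht₀.2⟩ u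
    obtain ⟨V, hV, hV'⟩ := h₁ m ⟨hac.trans_lt hm.1, hm.2⟩ (W m)
    exact ⟨_, (if_neg htb).trans hW, hV'.glue hcb hW' (agree V W hV' hW' hV)⟩

/-- Parallel fields along a smooth curve exist on bounded intervals. -/
theorem parallelExists {γ : ℝ → M} (hγ : ContMDiff 𝓘(ℝ, ℝ) 𝓘(ℝ, E) ∞ γ) {a b : ℝ} (hab : a ≤ b) :
    ParallelExists E γ a b := by
  choose δ hδ hex using exists_isParallelOn_nhds hγ
  obtain ⟨τ, hτ0, hmono, ⟨m, hm⟩, hcover⟩ := exists_monotone_Icc_subset_open_cover_Icc hab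
    (c := fun t : ℝ ↦ {s : Icc a b | (s : ℝ) ∈ Ioo (t - δ t) (t + δ t)})
    (fun t ↦ isOpen_Ioo.preimage continuous_subtype_val)
    (fun s _ ↦ mem_iUnion.2 ⟨s, by simp [hδ]⟩)
  -- glue the local fields along a subdivision, with a small overlap beyond each end
  have key : ∀ k, ∃ η > 0, ParallelExists E γ (a - η) (τ k + η) := by
    intro k
    induction k with
    | zero => exact ⟨δ a, hδ a, by rw [hτ0]; exact hex a⟩
    | succ k ih =>
      obtain ⟨η, hη, h⟩ := ih
      obtain ⟨t, ht⟩ := hcover k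
      have h1 : (τ k : ℝ) ∈ Ioo (t - δ t) (t + δ t) := ht ⟨le_rfl, hmono k.le_succ⟩
      have h2 : (τ (k + 1) : ℝ) ∈ Ioo (t - δ t) (t + δ t) := ht ⟨hmono k.le_succ, le_rfl⟩
      have h3 : a ≤ τ k := (τ k).2.1
      have h4 := (h.mono (c := a - η) (d := min (τ k + η) (t + δ t)) le_rfl (min_le_left _ _)).glue
        hγ (ParallelExists.mono (hex t)
          (c := max (a - η) (t - δ t)) (d := t + δ t) (le_max_right _ _) le_rfl)
        (le_max_left _ _) (by
          apply max_lt <;> apply lt_min <;> linarith [h1.1, h1.2, hδ t]) (min_le_right _ _)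
      refine ⟨min η (t + δ t - τ (k + 1)), lt_min hη (by linarith [h2.2]), h4.mono ?_ ?_⟩
      · linarith [min_le_left η (t + δ t - τ (k + 1))]
      · linarith [min_le_right η (t + δ t - τ (k + 1))]
  obtain ⟨η, hη, h⟩ := key m
  rw [hm m le_rfl] at h
  exact h.mono (by linarith) (by linarith)

/-- **Parallel transport**: every tangent vector at a point of a smooth curve extends to a parallel
field along the curve. -/
theorem exists_isParallelOn_univ {γ : ℝ → M} (hγ : ContMDiff 𝓘(ℝ, ℝ) 𝓘(ℝ, E) ∞ γ) (t₀ : ℝ)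
    (u : E) : ∃ V : ℝ → E, V t₀ = u ∧ IsParallelOn γ V univ := by
  have hex : ∀ r : ℝ, 0 < r → ∃ V : ℝ → E, V t₀ = u ∧ IsParallelOn γ V (Ioo (t₀ - r) (t₀ + r)) :=
    fun r hr ↦ parallelExists hγ (by linarith) t₀ ⟨by linarith, by linarith⟩ u
  choose! V hV0 hV using hex
  have hagree : ∀ r r' : ℝ, 0 < r → r ≤ r' → EqOn (V r) (V r') (Ioo (t₀ - r) (t₀ + r)) :=
    fun r r' hr hrr' ↦ (hV r hr).eqOn hγ isOpen_Ioo isPreconnected_Ioo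
      ((hV r' (hr.trans_le hrr')).mono (Ioo_subset_Ioo (by linarith) (by linarith)))
      (t := t₀) ⟨by linarith, by linarith⟩ (by rw [hV0 r hr, hV0 r' (hr.trans_le hrr')])
  -- at each time, use a field on an interval that contains this time in its interior
  refine ⟨fun s ↦ V (|s - t₀| + 1) s, hV0 _ (by positivity), fun t _ x₀ hx₀ ↦ ?_⟩
  have hlt := abs_lt.1 (lt_add_one |t - t₀|)
  refine ParallelInChart.congr (V := V (|t - t₀| + 2)) (hV _ (by positivity) t
    ⟨by linarith [hlt.1], by linarith [hlt.2]⟩ x₀ hx₀) ?_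
  filter_upwards [Ioo_mem_nhds (sub_one_lt t) (lt_add_one t)] with s hs
  have h1 : |s - t₀| ≤ |t - t₀| + 1 := by
    have := abs_sub_le s t t₀
    have h2 : |s - t| ≤ 1 := abs_le.2 ⟨by linarith [hs.1], by linarith [hs.2]⟩
    linarith
  have hlt' := abs_lt.1 (lt_add_one |s - t₀|)
  exact hagree _ _ (by positivity) (by linarith) ⟨by linarith [hlt'.1], by linarith [hlt'.2]⟩

/-- Parallel transport is evaluation of any parallel field, since these are unique. -/
theorem transport_eq {γ : ℝ → M} (hγ : ContMDiff 𝓘(ℝ, ℝ) 𝓘(ℝ, E) ∞ γ) {V : ℝ → E}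
    (hV : IsParallelOn γ V univ) (s t : ℝ) : transport (E := E) γ s t (V s) = V t := by
  have h : ∃ W : ∀ r, TangentSpace 𝓘(ℝ, E) (γ r), IsParallelAlong γ W ∧ W s = V s :=
    ⟨V, (isParallelAlong_iff γ V).2 hV, rfl⟩
  refine (dif_pos h).trans ?_
  have h1 := (isParallelAlong_iff γ _).1 h.choose_spec.1
  exact h1.eqOn hγ isOpen_univ isPreconnected_univ hV (mem_univ s) h.choose_spec.2 (mem_univ t)

/-- Parallel transport along a smooth curve, as a linear isometry. -/
theorem exists_transport_linearIsometry {γ : ℝ → M} (hγ : ContMDiff 𝓘(ℝ, ℝ) 𝓘(ℝ, E) ∞ γ)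
    (s t : ℝ) : ∃ Γ : TangentSpace 𝓘(ℝ, E) (γ s) →ₗᵢ[ℝ] TangentSpace 𝓘(ℝ, E) (γ t),
      ∀ u, transport γ s t u = Γ u := by
  choose V hV0 hV using fun u : E ↦ exists_isParallelOn_univ hγ s u
  have htr : ∀ u : E, transport (E := E) γ s t u = V u t := fun u ↦ by
    have := transport_eq hγ (hV u) s t
    rwa [hV0] at this
  have huniq : ∀ (u : E) (W : ℝ → E), IsParallelOn γ W univ → W s = u → V u t = W t :=
    fun u W hW h ↦ (hV u).eqOn hγ isOpen_univ isPreconnected_univ hW (mem_univ s)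
      ((hV0 u).trans h.symm) (mem_univ t)
  have hlin : ∀ (r : ℝ) (u w : E), V (r • u + w) t = r • V u t + V w t := fun r u w ↦
    huniq _ _ ((hV u).smul_add (hV w) r) (by rw [hV0, hV0])
  have hadd : ∀ u w : E, V (u + w) t = V u t + V w t := fun u w ↦ by
    simpa using hlin 1 u w
  have hzero : V 0 t = 0 := by simpa using hadd 0 0
  have hsmul : ∀ (r : ℝ) (u : E), V (r • u) t = r • V u t := fun r u ↦ by
    simpa [hzero] using hlin r u 0
  have hnorm : ∀ u : E, metricCLM (γ t) (V u t) (V u t) = metricCLM (γ s) u u := fun u ↦ by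
    have h := (hV u).metric_eq hγ isOpen_univ isPreconnected_univ (hV u) (mem_univ t) (mem_univ s)
    rwa [hV0] at h
  let Γ : TangentSpace 𝓘(ℝ, E) (γ s) →ₗ[ℝ] TangentSpace 𝓘(ℝ, E) (γ t) :=
    { toFun := fun u ↦ V u t, map_add' := hadd, map_smul' := hsmul }
  refine ⟨⟨Γ, fun u ↦ ?_⟩, htr⟩
  have h : inner ℝ (Γ u) (Γ u) = inner ℝ u u := hnorm u
  rw [real_inner_self_eq_norm_sq, real_inner_self_eq_norm_sq] at h
  exact (sq_eq_sq₀ (norm_nonneg _) (norm_nonneg _)).1 h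

end

/-! ### Geodesics and geodesically smooth functions -/

section

variable {E : Type*} [NormedAddCommGroup E] [NormedSpace ℝ E]
  {M : Type*} [TopologicalSpace M] [ChartedSpace E M] [IsManifold 𝓘(ℝ, E) ∞ M]
  [RiemannianBundle (fun x : M ↦ TangentSpace 𝓘(ℝ, E) x)]
    [IsContMDiffRiemannianBundle 𝓘(ℝ, E) ∞ E (fun x : M ↦ TangentSpace 𝓘(ℝ, E) x)]
  [FiniteDimensional ℝ E]

theorem ParallelInChart.scale {x₀ : M} {γ : ℝ → M} {V : ℝ → E} {r t : ℝ}
    (h : ParallelInChart x₀ γ V (r * t)) (hc : DifferentiableAt ℝ (coords x₀ γ : ℝ → E) (r * t))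
    (h₀ : γ (r * t) ∈ (chartAt E x₀).source) :
    ParallelInChart x₀ (fun s ↦ γ (r * s)) (fun s ↦ V (r * s)) t := by
  have hm : HasDerivAt (fun s : ℝ ↦ r * s) r t := by
    simpa using (hasDerivAt_id t).const_mul r
  have da : HasDerivAt (components x₀ (fun s ↦ γ (r * s)) (fun s ↦ V (r * s)))
      (r • deriv (components x₀ γ V) (r * t)) t := h.1.hasDerivAt.scomp t hm
  have dc : HasDerivAt (coords x₀ (fun s ↦ γ (r * s)))
      (r • deriv (coords x₀ γ : ℝ → E) (r * t)) t := hc.hasDerivAt.scomp t hm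
  refine ⟨da.differentiableAt, fun w ↦ ?_⟩
  have key := h.2 w
  rw [christoffel_eq (coords_mem_target h₀), ← chartMetricCLM_apply] at key
  rw [da.deriv, dc.deriv]
  change chartMetric x₀ (coords x₀ γ (r * t)) _ w
    + christoffel x₀ (coords x₀ γ (r * t)) _ (components x₀ γ V (r * t)) w = 0
  rw [christoffel_eq (coords_mem_target h₀), ← chartMetricCLM_apply]
  simp only [map_smul, smul_apply, smul_eq_mul]
  linear_combination r * key

theorem IsParallelOn.scale {γ : ℝ → M} (hγ : ContMDiff 𝓘(ℝ, ℝ) 𝓘(ℝ, E) ∞ γ) {V : ℝ → E}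
    (h : IsParallelOn γ V univ) (r : ℝ) :
    IsParallelOn (fun s ↦ γ (r * s)) (fun s ↦ V (r * s)) univ :=
  fun t _ x₀ h₀ ↦ ParallelInChart.scale (h (r * t) (mem_univ _) x₀ h₀)
    ((contDiffAt_coords hγ h₀).differentiableAt (by simp)) h₀

theorem IsParallelOn.const_smul {γ : ℝ → M} {V : ℝ → E} {s : Set ℝ} (h : IsParallelOn γ V s)
    (r : ℝ) : IsParallelOn γ (fun t ↦ r • V t) s := by
  have := h.smul_add h (r - 1)
  simpa only [sub_smul, one_smul, sub_add_cancel] using this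

theorem velocity_scale {γ : ℝ → M} (hγ : ContMDiff 𝓘(ℝ, ℝ) 𝓘(ℝ, E) ∞ γ) (r t : ℝ) :
    (velocity (E := E) (fun s ↦ γ (r * s)) t : E) = r • (velocity (E := E) γ (r * t) : E) := by
  have hm : HasMFDerivAt 𝓘(ℝ, ℝ) 𝓘(ℝ, ℝ) (fun s : ℝ ↦ r * s) t
      (ContinuousLinearMap.toSpanSingleton ℝ r) := by
    have : HasDerivAt (fun s : ℝ ↦ r * s) r t := by simpa using (hasDerivAt_id t).const_mul r
    exact this.hasFDerivAt.hasMFDerivAt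
  have h := (((hγ (r * t)).mdifferentiableAt (by simp)).hasMFDerivAt).comp t hm
  have h' : mfderiv 𝓘(ℝ, ℝ) 𝓘(ℝ, E) (fun s ↦ γ (r * s)) t = _ := h.mfderiv
  have h'' : (velocity (E := E) (fun s ↦ γ (r * s)) t : E) =
      (mfderiv 𝓘(ℝ, ℝ) 𝓘(ℝ, E) γ (r * t) : ℝ →L[ℝ] E) ((1 : ℝ) • r) :=
    congrArg (fun A : ℝ →L[ℝ] E ↦ A 1) h'
  have h3 : (mfderiv 𝓘(ℝ, ℝ) 𝓘(ℝ, E) γ (r * t) : ℝ →L[ℝ] E) (r • (1 : ℝ)) =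
      r • (mfderiv 𝓘(ℝ, ℝ) 𝓘(ℝ, E) γ (r * t) : ℝ →L[ℝ] E) 1 := ContinuousLinearMap.map_smul _ _ _
  rw [h'', one_smul]
  rw [smul_eq_mul, mul_one] at h3
  exact h3

theorem isGeodesic_iff (γ : ℝ → M) : IsGeodesic (E := E) γ ↔ ContMDiff 𝓘(ℝ, ℝ) 𝓘(ℝ, E) ∞ γ ∧
    IsParallelOn γ (velocity (E := E) γ) univ := by
  rw [IsGeodesic]
  exact and_congr_right fun _ ↦ isParallelAlong_iff γ _

theorem IsGeodesic.scale {γ : ℝ → M} (hγ : IsGeodesic (E := E) γ) (r : ℝ) :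
    IsGeodesic (E := E) (fun s ↦ γ (r * s)) := by
  rw [isGeodesic_iff] at hγ ⊢
  refine ⟨hγ.1.comp (contMDiff_iff_contDiff.2 (contDiff_const.mul contDiff_id)), ?_⟩
  have h := (hγ.2.scale hγ.1 r).const_smul r
  have e : (fun t ↦ (velocity (E := E) (fun s ↦ γ (r * s)) t : E)) =
      fun t ↦ r • (velocity (E := E) γ (r * t) : E) := funext fun t ↦ velocity_scale hγ.1 r t
  have h' : IsParallelOn (fun s ↦ γ (r * s))
    (fun t ↦ (velocity (E := E) (fun s ↦ γ (r * s)) t : E)) univ := by rw [e]; exact h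
  exact h'

theorem inner_grad (f : M → ℝ) (x : M) (v : TangentSpace 𝓘(ℝ, E) x) :
    inner ℝ (grad f x) v = mfderiv 𝓘(ℝ, E) 𝓘(ℝ, ℝ) f x v := by
  have : FiniteDimensional ℝ (TangentSpace 𝓘(ℝ, E) x) := inferInstanceAs (FiniteDimensional ℝ E)
  have : CompleteSpace (TangentSpace 𝓘(ℝ, E) x) := FiniteDimensional.complete ℝ _
  exact InnerProductSpace.toDual_symm_apply

theorem hasDerivAt_comp_curve {f : M → ℝ} (hf : MDifferentiable 𝓘(ℝ, E) 𝓘(ℝ, ℝ) f) {γ : ℝ → M}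
    (hγ : ContMDiff 𝓘(ℝ, ℝ) 𝓘(ℝ, E) ∞ γ) (t : ℝ) :
    HasDerivAt (fun s ↦ f (γ s)) (inner ℝ (grad f (γ t)) (velocity (E := E) γ t)) t := by
  have h := ((hf (γ t)).hasMFDerivAt).comp t (((hγ t).mdifferentiableAt (by simp)).hasMFDerivAt)
  rw [inner_grad]
  let A : E →L[ℝ] ℝ := mfderiv 𝓘(ℝ, E) 𝓘(ℝ, ℝ) f (γ t)
  let B : ℝ →L[ℝ] E := mfderiv 𝓘(ℝ, ℝ) 𝓘(ℝ, E) γ t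
  have h' : HasFDerivAt (fun s ↦ f (γ s)) (A ∘L B) t := hasMFDerivAt_iff_hasFDerivAt.1 h
  exact h'.hasDerivAt

/-- Geodesic smoothness in terms of a parallel field. -/
theorem GeodesicallySmooth.norm_sub_le {L : ℝ} {f : M → ℝ} (hf : GeodesicallySmooth E L f)
    {γ : ℝ → M} (hγ : IsGeodesic (E := E) γ)
    {V : ∀ t, TangentSpace 𝓘(ℝ, E) (γ t)} (hV : IsParallelOn γ V univ)
    (h1 : V 1 = grad f (γ 1)) :
    ‖grad f (γ 0) - V 0‖ ≤ L * ‖velocity (E := E) γ 0‖ := by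
  have h := hf.2 γ hγ
  have h2 : transport γ 1 0 (V 1) = V 0 := transport_eq hγ.1 hV 1 0
  rw [h1] at h2
  rwa [h2] at h

/-- Geodesic smoothness, applied to the part of a geodesic between the times `0` and `s`. -/
theorem GeodesicallySmooth.norm_sub_le_mul {L : ℝ} {f : M → ℝ} (hf : GeodesicallySmooth E L f)
    {γ : ℝ → M} (hγ : IsGeodesic (E := E) γ)
    {V : ∀ t, TangentSpace 𝓘(ℝ, E) (γ t)} (hV : IsParallelOn γ V univ) {s : ℝ}
    (hs : 0 ≤ s) (h1 : V s = grad f (γ s)) :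
    ‖grad f (γ 0) - V 0‖ ≤ L * (s * ‖velocity (E := E) γ 0‖) := by
  have h1' : ∀ p : ℝ, p = s → V p = grad f (γ p) := by
    rintro p rfl
    exact h1
  have h := GeodesicallySmooth.norm_sub_le hf (hγ.scale s) (V := fun r ↦ V (s * r))
    (hV.scale hγ.1 s) (h1' _ (mul_one s))
  have hv : (velocity (E := E) (fun r ↦ γ (s * r)) 0 : TangentSpace 𝓘(ℝ, E) (γ (s * 0))) =
    s • velocity (E := E) γ (s * 0) := velocity_scale hγ.1 s 0
  rw [hv, norm_smul, Real.norm_of_nonneg hs] at h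
  -- `γ (s * 0)` is `γ 0` only propositionally, so the basepoint is generalized
  have key : ∀ p : ℝ, p = 0 → ‖grad f (γ p) - V p‖ ≤
      L * (s * ‖velocity (E := E) γ p‖) → ‖grad f (γ 0) - V 0‖ ≤
      L * (s * ‖velocity (E := E) γ 0‖) := by
    rintro p rfl h
    exact h
  exact key _ (mul_zero s) h

/-- The quadratic upper bound for a geodesically smooth function along a geodesic. -/
theorem GeodesicallySmooth.le_quadratic {L : ℝ} {f : M → ℝ} (hf : GeodesicallySmooth E L f)
    {γ : ℝ → M} (hγ : IsGeodesic (E := E) γ) :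
    f (γ 1) ≤ f (γ 0) + inner ℝ (grad f (γ 0)) (velocity (E := E) γ 0)
      + L / 2 * ‖velocity (E := E) γ 0‖ ^ 2 := by
  set A : ℝ := inner ℝ (grad f (γ 0)) (velocity (E := E) γ 0) with hA
  set B : ℝ := ‖velocity (E := E) γ 0‖ with hB
  have hd : ∀ s : ℝ, HasDerivAt (fun s ↦ f (γ s) - s * A - L / 2 * B ^ 2 * s ^ 2)
      (inner ℝ (grad f (γ s)) (velocity (E := E) γ s) - A - L * s * B ^ 2) s := fun s ↦ by
    have h1 := (hasDerivAt_comp_curve hf.1 hγ.1 s).sub ((hasDerivAt_id s).mul_const A)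
    have h2 := h1.sub ((hasDerivAt_pow 2 s).const_mul (L / 2 * B ^ 2))
    refine h2.congr_deriv ?_
    simp
    ring
  have hle : ∀ s : ℝ, 0 ≤ s →
      inner ℝ (grad f (γ s)) (velocity (E := E) γ s) - A - L * s * B ^ 2 ≤ 0 := fun s hs ↦ by
    obtain ⟨V, hVs, hV⟩ : ∃ V : ∀ t, TangentSpace 𝓘(ℝ, E) (γ t), V s = grad f (γ s) ∧
        IsParallelOn γ V univ := exists_isParallelOn_univ hγ.1 s (grad (E := E) f (γ s))
    -- transport of gradient and velocity from time `s` back to time `0` keeps the inner product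
    have h1 : inner ℝ (grad f (γ s)) (velocity (E := E) γ s) =
        inner ℝ (V 0) (velocity (E := E) γ 0) := by
      rw [← hVs]
      exact hV.metric_eq hγ.1 isOpen_univ isPreconnected_univ ((isGeodesic_iff γ).1 hγ).2
        (mem_univ s) (mem_univ 0)
    have h2 := GeodesicallySmooth.norm_sub_le_mul hf hγ hV hs hVs
    have h3 := real_inner_le_norm (V 0 - grad f (γ 0))
      (velocity (E := E) γ 0)
    rw [inner_sub_left, norm_sub_rev] at h3
    have h4 := mul_le_mul_of_nonneg_right h2 (norm_nonneg (velocity (E := E) γ 0))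
    rw [h1]
    rw [← hB] at h3 h4
    nlinarith
  have hanti : AntitoneOn (fun s ↦ f (γ s) - s * A - L / 2 * B ^ 2 * s ^ 2) (Icc 0 1) := by
    refine antitoneOn_of_deriv_nonpos (convex_Icc 0 1)
      (fun s _ ↦ (hd s).continuousAt.continuousWithinAt)
      (fun s _ ↦ (hd s).differentiableAt.differentiableWithinAt) (fun s hs ↦ ?_)
    rw [interior_Icc] at hs
    rw [(hd s).deriv]
    exact hle s hs.1.le
  have := hanti (left_mem_Icc.2 zero_le_one) (right_mem_Icc.2 zero_le_one) zero_le_one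
  simp only at this
  linarith

theorem isGeodesicFrom_geodesic (hM : GeodesicallyComplete E M) (x : M)
    (v : TangentSpace 𝓘(ℝ, E) x) : IsGeodesicFrom x v (geodesic x v) := by
  have h := hM x v
  rw [geodesic, dif_pos h]
  exact h.choose_spec

/-- Properties of the initial point and velocity of a geodesic, which are only equal to `x` and `v`
as points of the tangent bundle, transfer to `x` and `v`. -/
theorem IsGeodesicFrom.elim {x : M} {v : TangentSpace 𝓘(ℝ, E) x} {γ : ℝ → M}
    (h : IsGeodesicFrom x v γ) {p : ∀ x : M, TangentSpace 𝓘(ℝ, E) x → Prop}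
    (hp : p (γ 0) (velocity (E := E) γ 0)) : p x v := by
  have h2 := h.2
  have := congrArg (fun w : TangentBundle 𝓘(ℝ, E) M ↦ p w.1 w.2) h2
  exact this.mp hp

/-- The quadratic upper bound for a geodesically smooth function. -/
theorem GeodesicallySmooth.exp_le {L : ℝ} {f : M → ℝ} (hf : GeodesicallySmooth E L f)
    (hM : GeodesicallyComplete E M) (x : M) (v : TangentSpace 𝓘(ℝ, E) x) :
    f (Exp x v) ≤ f x + inner ℝ (grad f x) v + L / 2 * ‖v‖ ^ 2 := by
  have h := isGeodesicFrom_geodesic hM x v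
  rw [Exp]
  generalize geodesic x v = γ at h
  exact h.elim (p := fun x v ↦ f (γ 1) ≤ f x + inner ℝ (grad f x) v + L / 2 * ‖v‖ ^ 2)
    (GeodesicallySmooth.le_quadratic hf h.1)

theorem IsGeodesicFrom.exists_transport_linearIsometry {x y : M} {v : TangentSpace 𝓘(ℝ, E) x}
    {γ : ℝ → M} (h : IsGeodesicFrom x v γ) (h₁ : γ 1 = y) :
    ∃ Γ : TangentSpace 𝓘(ℝ, E) x →ₗᵢ[ℝ] TangentSpace 𝓘(ℝ, E) y,
      (∀ (u : TangentSpace 𝓘(ℝ, E) x) (hx : γ 0 = x) (hy : γ 1 = y),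
        (hy ▸ transport γ 0 1 (hx.symm ▸ u) : TangentSpace 𝓘(ℝ, E) y) = Γ u) ∧
      ∀ (L : ℝ) (f : M → ℝ), GeodesicallySmooth E L f → ‖grad f y - Γ (grad f x)‖ ≤ L * ‖v‖ := by
  subst h₁
  refine h.elim (p := fun x v ↦ ∃ Γ : TangentSpace 𝓘(ℝ, E) x →ₗᵢ[ℝ] TangentSpace 𝓘(ℝ, E) (γ 1),
      (∀ (u : TangentSpace 𝓘(ℝ, E) x) (hx : γ 0 = x) (hy : γ 1 = γ 1),
        (hy ▸ transport γ 0 1 (hx.symm ▸ u) : TangentSpace 𝓘(ℝ, E) (γ 1)) = Γ u) ∧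
      ∀ (L : ℝ) (f : M → ℝ), GeodesicallySmooth E L f →
        ‖grad f (γ 1) - Γ (grad f x)‖ ≤ L * ‖v‖) ?_
  obtain ⟨Γ, hΓ⟩ := RSpider.exists_transport_linearIsometry h.1.1 0 1
  refine ⟨Γ, fun u _ _ ↦ hΓ u, fun L f hf ↦ ?_⟩
  obtain ⟨V, hV1, hV⟩ : ∃ V : ∀ t, TangentSpace 𝓘(ℝ, E) (γ t), V 1 = grad f (γ 1) ∧
      IsParallelOn γ V univ := exists_isParallelOn_univ h.1.1 1 (grad (E := E) f (γ 1))
  have h1 : Γ (V 0) = grad f (γ 1) := by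
    rw [← hV1, ← hΓ]
    exact transport_eq h.1.1 hV 0 1
  have h2 := GeodesicallySmooth.norm_sub_le hf h.1 hV hV1
  rwa [← h1, ← map_sub, Γ.norm_map, norm_sub_rev]

/-- The parallel transport used by the algorithm is a linear isometry, and it maps gradients of
geodesically smooth functions almost to gradients. -/
theorem exists_transportTo_linearIsometry (hM : GeodesicallyComplete E M)
    {x y : M} {v : TangentSpace 𝓘(ℝ, E) x} (hv : Exp x v = y) :
    ∃ Γ : TangentSpace 𝓘(ℝ, E) x →ₗᵢ[ℝ] TangentSpace 𝓘(ℝ, E) y,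
      (∀ u, transportTo x y v u = Γ u) ∧ ∀ (L : ℝ) (f : M → ℝ), GeodesicallySmooth E L f →
        ‖grad f y - Γ (grad f x)‖ ≤ L * ‖v‖ := by
  have h := isGeodesicFrom_geodesic hM x v
  obtain ⟨Γ, hΓ, hL⟩ := h.exists_transport_linearIsometry hv
  have h0 : geodesic x v 0 = x := congrArg TotalSpace.proj h.2
  exact ⟨Γ, fun u ↦ (dif_pos ⟨h0, hv⟩).trans (hΓ u h0 hv), hL⟩

/-- Gradients of geodesically smooth functions grow at most linearly along geodesics. -/
theorem GeodesicallySmooth.norm_grad_exp_le {L : ℝ} {f : M → ℝ} (hf : GeodesicallySmooth E L f)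
    (hM : GeodesicallyComplete E M) (x : M) (v : TangentSpace 𝓘(ℝ, E) x) :
    ‖grad (E := E) f (Exp x v)‖ ≤ ‖grad (E := E) f x‖ + L * ‖v‖ := by
  obtain ⟨Γ, -, hL⟩ := exists_transportTo_linearIsometry hM (rfl : Exp x v = Exp x v)
  have h := norm_add_le (grad (E := E) f (Exp x v) - Γ (grad f x)) (Γ (grad f x))
  have h' := hL L f hf
  rw [sub_add_cancel, Γ.norm_map] at h
  linarith

end

/-! ### Variance of sample averages -/

section

theorem Sampling.draws_nonempty (mode : Sampling) (n : ℕ) : (mode.draws n).Nonempty := by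
  refine ⟨id, ?_⟩
  cases mode <;> simp [Sampling.draws, Function.injective_id]

theorem Sampling.perm_comp_mem_draws (mode : Sampling) {n : ℕ} (σ : Equiv.Perm (Fin n))
    {b : Fin n → Fin n} (hb : b ∈ mode.draws n) : σ ∘ b ∈ mode.draws n := by
  cases mode with
  | withReplacement => simp [Sampling.draws]
  | withoutReplacement =>
    simp only [Sampling.draws, Finset.mem_filter, Finset.mem_univ, true_and] at hb ⊢
    exact σ.injective.comp hb

/-- Every entry of the random list is uniformly distributed. -/
theorem Sampling.sum_draws_apply (mode : Sampling) {n : ℕ} (hn : 0 < n) (φ : Fin n → ℝ)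
    (j : Fin n) : ∑ b ∈ mode.draws n, φ (b j) = (mode.draws n).card * ((n : ℝ)⁻¹ * ∑ i, φ i) := by
  have : NeZero n := ⟨hn.ne'⟩
  -- translating the list by a constant of `ℤ/n` permutes the outcomes
  have h1 : ∀ c : Fin n, ∑ b ∈ mode.draws n, φ (c + b j) = ∑ b ∈ mode.draws n, φ (b j) := by
    intro c
    refine Finset.sum_bij' (fun b _ ↦ Equiv.addLeft c ∘ b) (fun b _ ↦ Equiv.addLeft (-c) ∘ b)
      (fun b hb ↦ mode.perm_comp_mem_draws _ hb) (fun b hb ↦ mode.perm_comp_mem_draws _ hb)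
      ?_ ?_ ?_
    · intro b _; ext i; simp
    · intro b _; ext i; simp
    · intro b _; simp
  have h2 : ∑ c : Fin n, ∑ b ∈ mode.draws n, φ (c + b j) = n * ∑ b ∈ mode.draws n, φ (b j) := by
    simp [h1]
  rw [Finset.sum_comm] at h2
  have h3 : ∀ b : Fin n → Fin n, ∑ c : Fin n, φ (c + b j) = ∑ i, φ i := fun b ↦
    Equiv.sum_comp (Equiv.addRight (b j)) φ
  simp only [h3, Finset.sum_const, nsmul_eq_mul] at h2
  have hn' : (n : ℝ) ≠ 0 := by positivity
  field_simp
  linarith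

variable {H : Type*} [NormedAddCommGroup H] [InnerProductSpace ℝ H]

/-- Different entries of the random list are not positively correlated. -/
theorem Sampling.sum_draws_inner_nonpos (mode : Sampling) {n : ℕ} (g : Fin n → H)
    (hg : ∑ i, g i = 0) {j k : Fin n} (hjk : j ≠ k) :
    ∑ b ∈ mode.draws n, inner ℝ (g (b j)) (g (b k)) ≤ 0 := by
  have hn : 0 < n := j.pos
  have : NeZero n := ⟨hn.ne'⟩
  cases mode with
  | withReplacement =>
    simp only [Sampling.draws]
    -- translate the entry `k` alone
    have h1 : ∀ c : Fin n, ∑ b : Fin n → Fin n, inner ℝ (g (b j)) (g (c + b k)) =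
        ∑ b : Fin n → Fin n, inner ℝ (g (b j)) (g (b k)) := by
      intro c
      refine Finset.sum_bij' (fun b _ ↦ Function.update b k (c + b k))
        (fun b _ ↦ Function.update b k (-c + b k)) (by simp) (by simp) ?_ ?_ ?_
      · intro b _; simp
      · intro b _; simp
      · intro b _; simp [hjk]
    have h2 : ∑ c : Fin n, ∑ b : Fin n → Fin n, inner ℝ (g (b j)) (g (c + b k)) =
        n * ∑ b : Fin n → Fin n, inner ℝ (g (b j)) (g (b k)) := by
      simp [h1]
    rw [Finset.sum_comm] at h2
    have h3 : ∀ b : Fin n → Fin n, ∑ c : Fin n, inner ℝ (g (b j)) (g (c + b k)) = 0 := fun b ↦ by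
      have : ∑ i, g (i + b k) = 0 := (Equiv.sum_comp (Equiv.addRight (b k)) g).trans hg
      rw [← inner_sum, this, inner_zero_right]
    simp only [h3, Finset.sum_const_zero] at h2
    have hn' : (n : ℝ) ≠ 0 := by positivity
    exact ((mul_eq_zero.1 h2.symm).resolve_left hn').le
  | withoutReplacement =>
    set D := Sampling.withoutReplacement.draws n with hD
    have hmem : ∀ b, b ∈ D ↔ Function.Injective b := fun b ↦ by simp [hD, Sampling.draws]
    -- the `n - 1` correlations of the entry `j` with the others are equal by symmetry, and together
    -- with its second moment they add up to zero
    have h1 : ∀ k', k' ≠ j → ∑ b ∈ D, inner ℝ (g (b j)) (g (b k')) =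
        ∑ b ∈ D, inner ℝ (g (b j)) (g (b k)) := by
      intro k' hk'
      refine Finset.sum_bij' (fun b _ ↦ b ∘ Equiv.swap k k') (fun b _ ↦ b ∘ Equiv.swap k k')
        ?_ ?_ ?_ ?_ ?_
      · intro b hb
        exact (hmem _).2 (((hmem b).1 hb).comp (Equiv.injective _))
      · intro b hb
        exact (hmem _).2 (((hmem b).1 hb).comp (Equiv.injective _))
      · intro b _; ext i; simp
      · intro b _; ext i; simp
      · intro b _; simp [Equiv.swap_apply_of_ne_of_ne hjk hk'.symm]
    have h2 : ∑ k', ∑ b ∈ D, inner ℝ (g (b j)) (g (b k')) = 0 := by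
      rw [Finset.sum_comm]
      refine Finset.sum_eq_zero fun b hb ↦ ?_
      rw [← inner_sum, (Finite.injective_iff_bijective.1 ((hmem b).1 hb)).sum_comp g, hg,
        inner_zero_right]
    rw [← Finset.add_sum_erase _ _ (Finset.mem_univ j),
      Finset.sum_congr rfl fun k' hk' ↦ h1 k' (Finset.ne_of_mem_erase hk'), Finset.sum_const,
      nsmul_eq_mul] at h2
    have h3 : 0 ≤ ∑ b ∈ D, inner ℝ (g (b j)) (g (b j)) :=
      Finset.sum_nonneg fun b _ ↦ real_inner_self_nonneg
    have h4 : 0 < ((Finset.univ.erase j).card : ℝ) := by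
      exact_mod_cast Finset.card_pos.2 ⟨k, by simp [hjk.symm]⟩
    by_contra! h5
    nlinarith

/-- The second moment of the average of a centred function over a sample, plus a constant. -/
theorem Sampling.expect_norm_sq_le (mode : Sampling) {n : ℕ} (g : Fin n → H)
    (hg : ∑ i, g i = 0) (c : H) {S : ℕ} (hS : 0 < S) (hSn : S < n) :
    (mode.draws n).expect (fun b ↦ ‖batchMean b S g + c‖ ^ 2) ≤
      ‖c‖ ^ 2 + (S : ℝ)⁻¹ * ((n : ℝ)⁻¹ * ∑ i, ‖g i‖ ^ 2) := by
  have hn : 0 < n := hS.trans hSn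
  set D := mode.draws n with hD
  have hDc : 0 < (D.card : ℝ) := by exact_mod_cast (mode.draws_nonempty n).card_pos
  set J : Finset (Fin n) := Finset.univ.filter (fun j : Fin n ↦ (j : ℕ) < S) with hJ
  have hJc : (J.card : ℝ) = S := by
    have : J.card = S := by
      rw [hJ, Fin.card_filter_val_lt, min_eq_right hSn.le]
    exact_mod_cast this
  have hbm : ∀ b, batchMean b S g = (S : ℝ)⁻¹ • ∑ j ∈ J, g (b j) := fun b ↦ by
    rw [batchMean, if_neg (by omega)]
  have hexp : ∀ b, ‖batchMean b S g + c‖ ^ 2 = ((S : ℝ)⁻¹) ^ 2 * ∑ j ∈ J, ∑ k ∈ J,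
      inner ℝ (g (b j)) (g (b k)) + 2 * ((S : ℝ)⁻¹ * ∑ j ∈ J, inner ℝ (g (b j)) c) + ‖c‖ ^ 2 := by
    intro b
    rw [hbm, norm_add_sq_real, norm_smul, mul_pow, ← real_inner_self_eq_norm_sq (∑ j ∈ J, g (b j)),
      sum_inner, real_inner_smul_left, sum_inner]
    simp [inner_sum]
  have hcross : ∀ j, ∑ b ∈ D, inner ℝ (g (b j)) c = 0 := fun j ↦ by
    rw [mode.sum_draws_apply hn (fun i ↦ inner ℝ (g i) c) j, ← sum_inner, hg]
    simp
  have hdiag : ∀ j ∈ J, ∑ k ∈ J, ∑ b ∈ D, inner ℝ (g (b j)) (g (b k)) ≤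
      D.card * ((n : ℝ)⁻¹ * ∑ i, ‖g i‖ ^ 2) := fun j hj ↦ by
    rw [← Finset.add_sum_erase _ _ hj]
    have h1 : ∑ b ∈ D, inner ℝ (g (b j)) (g (b j)) = D.card * ((n : ℝ)⁻¹ * ∑ i, ‖g i‖ ^ 2) := by
      simp only [real_inner_self_eq_norm_sq]
      exact mode.sum_draws_apply hn (fun i ↦ ‖g i‖ ^ 2) j
    have h2 : ∑ k ∈ J.erase j, ∑ b ∈ D, inner ℝ (g (b j)) (g (b k)) ≤ 0 :=
      Finset.sum_nonpos fun k hk ↦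
        mode.sum_draws_inner_nonpos g hg (Finset.ne_of_mem_erase hk).symm
    linarith
  have hsum : ∑ b ∈ D, ‖batchMean b S g + c‖ ^ 2 ≤
      D.card * (‖c‖ ^ 2 + (S : ℝ)⁻¹ * ((n : ℝ)⁻¹ * ∑ i, ‖g i‖ ^ 2)) := by
    simp only [hexp, Finset.sum_add_distrib, ← Finset.mul_sum, Finset.sum_const, nsmul_eq_mul]
    have h1 : ∑ b ∈ D, ∑ j ∈ J, ∑ k ∈ J, inner ℝ (g (b j)) (g (b k)) ≤
        S * (D.card * ((n : ℝ)⁻¹ * ∑ i, ‖g i‖ ^ 2)) := by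
      rw [Finset.sum_comm]
      simp_rw [Finset.sum_comm (s := D)]
      refine (Finset.sum_le_sum hdiag).trans_eq ?_
      rw [Finset.sum_const, nsmul_eq_mul, hJc]
    have h2 : ∑ b ∈ D, ∑ j ∈ J, inner ℝ (g (b j)) c = 0 := by
      rw [Finset.sum_comm]
      exact Finset.sum_eq_zero fun j _ ↦ hcross j
    have hS' : (S : ℝ) ≠ 0 := by positivity
    have h3 := mul_le_mul_of_nonneg_left h1 (sq_nonneg (S : ℝ)⁻¹)
    have h4 : ((S : ℝ)⁻¹) ^ 2 * (S * (D.card * ((n : ℝ)⁻¹ * ∑ i, ‖g i‖ ^ 2))) =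
        D.card * ((S : ℝ)⁻¹ * ((n : ℝ)⁻¹ * ∑ i, ‖g i‖ ^ 2)) := by
      field_simp
    rw [h2]
    linarith
  rw [Finset.expect_eq_sum_div_card, div_le_iff₀ hDc]
  linarith

/-- Centring does not increase the second moment. -/
theorem sum_norm_sub_mean_sq_le {n : ℕ} (h : Fin n → H) :
    ∑ i, ‖h i - (n : ℝ)⁻¹ • ∑ k, h k‖ ^ 2 ≤ ∑ i, ‖h i‖ ^ 2 := by
  rcases Nat.eq_zero_or_pos n with rfl | hn
  · simp
  have hn' : (n : ℝ) ≠ 0 := by positivity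
  set m := (n : ℝ)⁻¹ • ∑ k, h k with hm
  have h1 : ∑ i, inner ℝ (h i) m = n * ‖m‖ ^ 2 := by
    rw [← sum_inner, ← real_inner_self_eq_norm_sq]
    have : ∑ i, h i = (n : ℝ) • m := by rw [hm, smul_inv_smul₀ hn']
    rw [this, real_inner_smul_left]
  have h2 : ∑ i, ‖h i - m‖ ^ 2 = ∑ i, ‖h i‖ ^ 2 - n * ‖m‖ ^ 2 := by
    simp only [norm_sub_sq_real, Finset.sum_add_distrib, Finset.sum_sub_distrib, ← Finset.mul_sum,
      h1, Finset.sum_const, nsmul_eq_mul, Finset.card_univ, Fintype.card_fin]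
    ring
  rw [h2]
  have : 0 ≤ (n : ℝ) * ‖m‖ ^ 2 := by positivity
  linarith

end

/-! ### One pass of the algorithm -/

section

section BatchMean

variable {n : ℕ} {F F' : Type*} [AddCommGroup F] [Module ℝ F] [AddCommGroup F'] [Module ℝ F']

theorem batchMean_of_le (b : Fin n → Fin n) {S : ℕ} (hS : n ≤ S) (h : Fin n → F) :
    batchMean b S h = (n : ℝ)⁻¹ • ∑ i, h i := if_pos hS

theorem map_batchMean (A : F →ₗ[ℝ] F') (b : Fin n → Fin n) (S : ℕ) (h : Fin n → F) :
    A (batchMean b S h) = batchMean b S (fun i ↦ A (h i)) := by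
  unfold batchMean
  split_ifs <;> simp [map_sum]

theorem batchMean_sub (b : Fin n → Fin n) (S : ℕ) (h h' : Fin n → F) :
    batchMean b S (fun i ↦ h i - h' i) = batchMean b S h - batchMean b S h' := by
  unfold batchMean
  split_ifs <;> simp [smul_sub]

theorem batchMean_const (b : Fin n → Fin n) {S : ℕ} (hS : 0 < S) (hSn : S < n) (m : F) :
    batchMean b S (fun _ ↦ m) = m := by
  have hS' : (S : ℝ) ≠ 0 := by positivity
  rw [batchMean, if_neg (by omega), Finset.sum_const, Fin.card_filter_val_lt, min_eq_right hSn.le,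
    ← Nat.cast_smul_eq_nsmul ℝ, inv_smul_smul₀ hS']

end BatchMean

/-- If `n`, or `S < n` random samples are used, where `S` is at least `K² / δ`, then the average of
vectors of norm at most `K` over the sample has variance at most `δ`. -/
theorem Sampling.expect_batchMean_sub_mean_add_le {H : Type*} [NormedAddCommGroup H]
    [InnerProductSpace ℝ H] (mode : Sampling) {n : ℕ} (hn : 0 < n) (h : Fin n → H) (c : H) {S : ℕ}
    {K δ : ℝ} (hK : ∀ i, ‖h i‖ ≤ K) (hδ : 0 ≤ δ) (hS : S < n → K ^ 2 ≤ S * δ) :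
    (mode.draws n).expect (fun b ↦ ‖batchMean b S h - (n : ℝ)⁻¹ • ∑ i, h i + c‖ ^ 2) ≤
      ‖c‖ ^ 2 + δ := by
  have hne := mode.draws_nonempty n
  have hn' : (n : ℝ) ≠ 0 := by positivity
  rcases le_or_gt n S with hSn | hSn
  · simp only [batchMean_of_le _ hSn, sub_self, zero_add, Finset.expect_const hne]
    linarith
  have hS := hS hSn
  -- an empty sample is drawn only if all vectors vanish
  rcases Nat.eq_zero_or_pos S with rfl | hS0
  · have hzero : h = 0 := by
      ext i
      have h1 := hK i
      have h2 := norm_nonneg (h i)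
      have : ‖h i‖ ^ 2 ≤ 0 := by
        have := pow_le_pow_left₀ h2 h1 2
        simp only [Nat.cast_zero, zero_mul] at hS
        linarith
      exact norm_eq_zero.1 (pow_eq_zero_iff two_ne_zero |>.1 (le_antisymm this (sq_nonneg _)))
    have : ∀ b : Fin n → Fin n, batchMean b 0 h - (n : ℝ)⁻¹ • ∑ i, h i = 0 := fun b ↦ by
      simp [hzero, batchMean]
    simp only [this, zero_add, Finset.expect_const hne]
    linarith
  have hS' : (0 : ℝ) < S := by exact_mod_cast hS0
  set m := (n : ℝ)⁻¹ • ∑ i, h i with hm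
  have h1 : ∀ b : Fin n → Fin n, batchMean b S h - m = batchMean b S (fun i ↦ h i - m) :=
    fun b ↦ by rw [batchMean_sub, batchMean_const b hS0 hSn]
  have h2 : ∑ i, (h i - m) = 0 := by
    rw [Finset.sum_sub_distrib, Finset.sum_const, Finset.card_univ, Fintype.card_fin, hm,
      ← Nat.cast_smul_eq_nsmul ℝ, smul_inv_smul₀ hn', sub_self]
  simp only [h1]
  refine (mode.expect_norm_sq_le _ h2 c hS0 hSn).trans (add_le_add_right ?_ _)
  have h3 : (n : ℝ)⁻¹ * ∑ i, ‖h i - m‖ ^ 2 ≤ K ^ 2 := by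
    have h4 : ∑ i, ‖h i‖ ^ 2 ≤ ∑ _i : Fin n, K ^ 2 :=
      Finset.sum_le_sum fun i _ ↦ pow_le_pow_left₀ (norm_nonneg _) (hK i) 2
    rw [Finset.sum_const, Finset.card_univ, Fintype.card_fin, nsmul_eq_mul] at h4
    rw [inv_mul_le_iff₀ (by positivity)]
    exact (sum_norm_sub_mean_sq_le h).trans h4
  rw [inv_mul_le_iff₀ hS']
  exact h3.trans hS

variable {E : Type*} [NormedAddCommGroup E] [NormedSpace ℝ E]
  {M : Type*} [TopologicalSpace M] [ChartedSpace E M] [IsManifold 𝓘(ℝ, E) ∞ M]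
  [RiemannianBundle (fun x : M ↦ TangentSpace 𝓘(ℝ, E) x)]
    [IsContMDiffRiemannianBundle 𝓘(ℝ, E) ∞ E (fun x : M ↦ TangentSpace 𝓘(ℝ, E) x)]
  [FiniteDimensional ℝ E]

theorem hasMFDerivAt_mean {n : ℕ} {f : Fin n → M → ℝ} {F : M → ℝ}
    (hF : ∀ x, F x = 1 / (n : ℝ) * ∑ i, f i x)
    (hf : ∀ i, MDifferentiable 𝓘(ℝ, E) 𝓘(ℝ, ℝ) (f i)) (x : M) :
    HasMFDerivAt 𝓘(ℝ, E) 𝓘(ℝ, ℝ) F x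
      ((n : ℝ)⁻¹ • ∑ i, (mfderiv 𝓘(ℝ, E) 𝓘(ℝ, ℝ) (f i) x : E →L[ℝ] ℝ)) := by
  have h := (HasMFDerivAt.sum (t := Finset.univ) (f := f) (z := x) (I := 𝓘(ℝ, E))
    (f' := fun i ↦ (mfderiv 𝓘(ℝ, E) 𝓘(ℝ, ℝ) (f i) x : E →L[ℝ] ℝ))
    (fun i _ ↦ (hf i x).hasMFDerivAt)).const_smul (n : ℝ)⁻¹
  have e : F = (n : ℝ)⁻¹ • ∑ i, f i := by
    ext x
    simp [hF]
  rw [e]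
  exact h

theorem grad_mean {n : ℕ} {f : Fin n → M → ℝ} {F : M → ℝ}
    (hF : ∀ x, F x = 1 / (n : ℝ) * ∑ i, f i x)
    (hf : ∀ i, MDifferentiable 𝓘(ℝ, E) 𝓘(ℝ, ℝ) (f i)) (x : M) :
    grad (E := E) F x = (n : ℝ)⁻¹ • ∑ i, grad (f i) x := by
  refine ext_inner_right ℝ fun v ↦ ?_
  rw [real_inner_smul_left, sum_inner]
  simp only [inner_grad]
  rw [(hasMFDerivAt_mean hF hf x).mfderiv]
  let A : Fin n → E →L[ℝ] ℝ := fun i ↦ mfderiv 𝓘(ℝ, E) 𝓘(ℝ, ℝ) (f i) x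
  have h (w : E) : ((n : ℝ)⁻¹ • ∑ i, A i) w = (n : ℝ)⁻¹ * ∑ i, A i w := by simp
  exact h v

theorem norm_mean_le {H : Type*} [SeminormedAddCommGroup H] [NormedSpace ℝ H] {n : ℕ} (hn : 0 < n)
    (h : Fin n → H) {K : ℝ} (hK : ∀ i, ‖h i‖ ≤ K) : ‖(n : ℝ)⁻¹ • ∑ i, h i‖ ≤ K := by
  have hn' : (0 : ℝ) < n := by exact_mod_cast hn
  rw [norm_smul, norm_inv, Real.norm_natCast, inv_mul_le_iff₀ hn']
  refine (norm_sum_le _ _).trans ((Finset.sum_le_sum fun i _ ↦ hK i).trans_eq ?_)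
  simp

/-- The average of geodesically smooth functions is geodesically smooth. -/
theorem GeodesicallySmooth.mean {n : ℕ} (hn : 0 < n) {f : Fin n → M → ℝ} {F : M → ℝ}
    (hF : ∀ x, F x = 1 / (n : ℝ) * ∑ i, f i x) {L : ℝ} (hf : ∀ i, GeodesicallySmooth E L (f i)) :
    GeodesicallySmooth E L F := by
  have hd := fun i ↦ (hf i).1
  refine ⟨fun x ↦ (hasMFDerivAt_mean hF hd x).mdifferentiableAt, fun γ hγ ↦ ?_⟩
  obtain ⟨Γ, hΓ⟩ := exists_transport_linearIsometry hγ.1 1 0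
  have h : grad (E := E) F (γ 0) - transport γ 1 0 (grad (E := E) F (γ 1)) =
      (n : ℝ)⁻¹ • ∑ i, (grad (f i) (γ 0) - transport γ 1 0 (grad (E := E) (f i) (γ 1))) := by
    simp only [hΓ, grad_mean hF hd, map_smul, map_sum, Finset.sum_sub_distrib, smul_sub]
  rw [h]
  exact norm_mean_le hn _ fun i ↦ (hf i).2 γ hγ

variable {n : ℕ} {f : Fin n → M → ℝ} {log : ∀ x _ : M, TangentSpace 𝓘(ℝ, E) x} {P : Params}

/-- The squared error of the gradient estimator of the last pass. -/
def estimatorError (F : M → ℝ) (s : State E M) : ℝ := ‖s.prev.2 - grad F s.prev.1‖ ^ 2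

/-- The squared norm of the gradient estimator of the last pass. -/
def estimatorNormSq (s : State E M) : ℝ := ‖s.prev.2‖ ^ 2

/-- The iterate of the state is the endpoint of the step made in the last pass. -/
def State.IsStep (η : ℝ) (s : State E M) : Prop := s.x = Exp s.prev.1 (-η • s.prev.2)

theorem estimatorError_pass (F : M → ℝ) (s : State E M) (b : Fin n → Fin n) :
    estimatorError F (pass f log P b s) = ‖estimator f log P b s - grad F s.x‖ ^ 2 := rfl

theorem estimatorNormSq_pass (s : State E M) (b : Fin n → Fin n) :
    estimatorNormSq (pass f log P b s) = ‖estimator f log P b s‖ ^ 2 := rfl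

theorem pass_x (s : State E M) (b : Fin n → Fin n) :
    (pass f log P b s).x = Exp s.x (-P.η • estimator f log P b s) := rfl

theorem estimatorError_pass_of_full {F : M → ℝ}
    (hF : ∀ x, F x = 1 / (n : ℝ) * ∑ i, f i x)
    (hf : ∀ i, MDifferentiable 𝓘(ℝ, E) 𝓘(ℝ, ℝ) (f i)) (hS₁ : P.S₁ = n) {s : State E M}
    (hs : s.t % P.q = 0) (b : Fin n → Fin n) :
    estimatorError F (pass f log P b s) = 0 := by
  rw [estimatorError_pass, estimator, if_pos hs, batchMean_of_le _ hS₁.ge, grad_mean hF hf,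
    sub_self, norm_zero, zero_pow two_ne_zero]

/-- The error of the estimator grows by at most `2 ε² / q` in expectation in a pass with a random
sample: the new error is the sum of the transported old error and a sampling error of mean zero. -/
theorem expect_estimatorError_pass_le (hM : GeodesicallyComplete E M) (hlog : IsInverseExp log)
    (mode : Sampling) (hn : 0 < n) {F : M → ℝ}
    (hF : ∀ x, F x = 1 / (n : ℝ) * ∑ i, f i x) (hf : ∀ i, GeodesicallySmooth E P.L (f i))
    (hq : 0 < P.q) (hε : 0 < P.ε) {s : State E M} (hs : s.t % P.q ≠ 0) (hstep : s.IsStep P.η) :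
    (mode.draws n).expect (fun b ↦ estimatorError F (pass f log P b s)) ≤
      estimatorError F s + 2 * P.ε ^ 2 / P.q := by
  obtain ⟨t, y, ⟨x, v⟩, calls⟩ := s
  have hstep : y = Exp x (-P.η • v) := hstep
  have hy : Exp x (log x y) = y := by rw [hstep]; exact (hlog x _).1
  obtain ⟨Γ, hΓ, hL⟩ := exists_transportTo_linearIsometry hM hy
  set S := S₂ log P n (⟨t, y, ⟨x, v⟩, calls⟩ : State E M) with hS
  set w := log x y with hw
  have hd := fun i ↦ (hf i).1
  -- sampling error of the gradient differences, plus the transported old error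
  have key : ∀ b : Fin n → Fin n, estimator f log P b ⟨t, y, ⟨x, v⟩, calls⟩ - grad F y =
      batchMean b S (fun i ↦ grad (f i) y - Γ (grad (f i) x)) -
        (n : ℝ)⁻¹ • ∑ i, (grad (f i) y - Γ (grad (f i) x)) + Γ (v - grad F x) := fun b ↦ by
    have h1 : Γ (batchMean b S fun i ↦ grad (f i) x) = batchMean b S fun i ↦ Γ (grad (f i) x) :=
      map_batchMean Γ.toLinearMap b S _
    have h2 : estimator f log P b ⟨t, y, ⟨x, v⟩, calls⟩ = batchMean b S (fun i ↦ grad (f i) y) -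
        transportTo x y w (batchMean b S (fun i ↦ grad (f i) x) - v) := if_neg hs
    rw [h2, hΓ, map_sub, map_sub, batchMean_sub, grad_mean hF hd, grad_mean hF hd, h1, map_smul,
      map_sum, Finset.sum_sub_distrib, smul_sub]
    abel
  simp only [estimatorError_pass, key]
  have hq' : (0 : ℝ) < P.q := by exact_mod_cast hq
  have hvar := mode.expect_batchMean_sub_mean_add_le hn
    (fun i ↦ grad (f i) y - Γ (grad (f i) x)) (Γ (v - grad F x)) (S := S)
    (δ := 2 * P.ε ^ 2 / P.q) (fun i ↦ hL P.L (f i) (hf i)) (by positivity) (fun hSn ↦ by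
      have h1 : min (n : ℝ) (P.q * P.L ^ 2 * ‖w‖ ^ 2 / (2 * P.ε ^ 2)) ≤ S := Nat.le_ceil _
      have h2 : (S : ℝ) < n := by exact_mod_cast hSn
      have h3 : P.q * P.L ^ 2 * ‖w‖ ^ 2 / (2 * P.ε ^ 2) ≤ S := by
        rcases min_le_iff.1 h1 with h | h
        · linarith
        · exact h
      rw [div_le_iff₀ (by positivity)] at h3
      rw [mul_div_assoc', le_div_iff₀ hq']
      linarith)
  rw [Γ.norm_map] at hvar
  exact hvar

/-- The decrease of the objective in one pass. -/
theorem objective_pass_le (hM : GeodesicallyComplete E M) {F : M → ℝ}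
    (hF : GeodesicallySmooth E P.L F) (hL : 0 < P.L) (hη : P.η = 1 / (2 * P.L)) (s : State E M)
    (b : Fin n → Fin n) :
    ‖grad (E := E) F s.x‖ ^ 2 + estimatorNormSq (pass f log P b s) / 2 ≤
      4 * P.L * (F s.x - F (pass f log P b s).x) + estimatorError F (pass f log P b s) := by
  rw [estimatorError_pass, estimatorNormSq_pass, pass_x]
  set v := estimator f log P b s with hv
  have h1 := GeodesicallySmooth.exp_le hF hM s.x (-P.η • v)
  rw [real_inner_smul_right, norm_smul, norm_neg, mul_pow, Real.norm_eq_abs, sq_abs, hη] at h1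
  rw [hη]
  have h2 := norm_sub_sq_real v (grad F s.x)
  rw [real_inner_comm] at h2
  have h3 : 4 * P.L * (-(1 / (2 * P.L)) * inner ℝ (grad F s.x) v +
      P.L / 2 * ((1 / (2 * P.L)) ^ 2 * ‖v‖ ^ 2)) = -2 * inner ℝ (grad F s.x) v + ‖v‖ ^ 2 / 2 := by
    field_simp
    ring
  have h4 : 0 < 4 * P.L := by positivity
  nlinarith

/-- The gradient at the new iterate, in terms of the gradient at the old one and the step. -/
theorem norm_grad_pass_sq_le (hM : GeodesicallyComplete E M) {F : M → ℝ}
    (hF : GeodesicallySmooth E P.L F) (hL : 0 < P.L) (hη : P.η = 1 / (2 * P.L)) (s : State E M)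
    (b : Fin n → Fin n) :
    ‖grad (E := E) F (pass f log P b s).x‖ ^ 2 ≤
      3 / 2 * (‖grad (E := E) F s.x‖ ^ 2 + estimatorNormSq (pass f log P b s) / 2) := by
  rw [estimatorNormSq_pass, pass_x]
  set v := estimator f log P b s with hv
  have h1 := GeodesicallySmooth.norm_grad_exp_le hF hM s.x (-P.η • v)
  have h2 : P.L * ‖-P.η • v‖ = ‖v‖ / 2 := by
    rw [norm_smul, norm_neg, hη, Real.norm_of_nonneg (by positivity)]
    field_simp
  rw [h2] at h1
  have h3 := pow_le_pow_left₀ (norm_nonneg _) h1 2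
  -- `(a + c / 2)² ≤ 3 / 2 * (a² + c² / 2)`, with difference `(a - c)² / 2`
  nlinarith [sq_nonneg (‖grad (E := E) F s.x‖ - ‖v‖)]

/-- The cost of a pass with a random sample. -/
theorem passCalls_le (hlog : IsInverseExp log) (hL : 0 < P.L) (hη : P.η = 1 / (2 * P.L))
    (hε : 0 < P.ε) {s : State E M} (hs : s.t % P.q ≠ 0) (hstep : s.IsStep P.η) :
    (passCalls log P n s : ℝ) ≤ 2 + P.q / (4 * P.ε ^ 2) * estimatorNormSq s := by
  obtain ⟨t, y, ⟨x, v⟩, calls⟩ := s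
  have hstep : y = Exp x (-P.η • v) := hstep
  rw [passCalls, if_neg hs]
  change _ ≤ 2 + P.q / (4 * P.ε ^ 2) * ‖v‖ ^ 2
  have h1 : ‖log x y‖ ≤ ‖v‖ / (2 * P.L) := by
    rw [hstep]
    refine (hlog x _).2.trans_eq ?_
    rw [norm_smul, norm_neg, hη, Real.norm_of_nonneg (by positivity)]
    ring
  have h2 : P.q * P.L ^ 2 * ‖log x y‖ ^ 2 / (2 * P.ε ^ 2) ≤ P.q / (8 * P.ε ^ 2) * ‖v‖ ^ 2 := by
    have h3 := pow_le_pow_left₀ (norm_nonneg _) h1 2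
    calc P.q * P.L ^ 2 * ‖log x y‖ ^ 2 / (2 * P.ε ^ 2)
        ≤ P.q * P.L ^ 2 * (‖v‖ / (2 * P.L)) ^ 2 / (2 * P.ε ^ 2) := by gcongr
      _ = P.q / (8 * P.ε ^ 2) * ‖v‖ ^ 2 := by field_simp; ring
  have h4 : (S₂ log P n (⟨t, y, ⟨x, v⟩, calls⟩ : State E M) : ℝ) <
      min (n : ℝ) (P.q * P.L ^ 2 * ‖log x y‖ ^ 2 / (2 * P.ε ^ 2)) + 1 :=
    Nat.ceil_lt_add_one (by positivity)
  have h5 := min_le_right (n : ℝ) (P.q * P.L ^ 2 * ‖log x y‖ ^ 2 / (2 * P.ε ^ 2))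
  have h6 : P.q / (4 * P.ε ^ 2) * ‖v‖ ^ 2 = 2 * (P.q / (8 * P.ε ^ 2) * ‖v‖ ^ 2) := by
    field_simp
    ring
  push_cast
  rw [h6]
  linarith

end

/-! ### Expectations over all passes -/

section

theorem outcomes_nonempty (mode : Sampling) (n N : ℕ) : (outcomes mode n N).Nonempty :=
  Fintype.piFinset_nonempty.2 fun _ ↦ mode.draws_nonempty n

/-- Drawing the list of one pass again does not change expectations. -/
theorem expect_outcomes_update (mode : Sampling) {n N : ℕ} (t : Fin N)
    (φ : (Fin N → Fin n → Fin n) → ℝ) :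
    (outcomes mode n N).expect φ = (outcomes mode n N).expect fun o ↦
      (mode.draws n).expect fun b ↦ φ (Function.update o t b) := by
  have hD : ((mode.draws n).card : ℝ) ≠ 0 := by
    exact_mod_cast (mode.draws_nonempty n).card_pos.ne'
  have hmem : ∀ o b, o ∈ outcomes mode n N → b ∈ mode.draws n →
      Function.update o t b ∈ outcomes mode n N := fun o b ho hb ↦ by
    rw [outcomes, Fintype.mem_piFinset] at ho ⊢
    intro i
    rcases eq_or_ne i t with rfl | hi
    · simpa using hb
    · simpa [hi] using ho i
  have hval : ∀ o, o ∈ outcomes mode n N → o t ∈ mode.draws n := fun o ho ↦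
    Fintype.mem_piFinset.1 ho t
  -- exchanging the redrawn list with the original one is an involution of the pairs
  have h : ∑ p ∈ outcomes mode n N ×ˢ mode.draws n, φ (Function.update p.1 t p.2) =
      ∑ p ∈ outcomes mode n N ×ˢ mode.draws n, φ p.1 := by
    refine Finset.sum_bij' (fun p _ ↦ (Function.update p.1 t p.2, p.1 t))
      (fun p _ ↦ (Function.update p.1 t p.2, p.1 t)) ?_ ?_ ?_ ?_ ?_
    · intro p hp
      rw [Finset.mem_product] at hp ⊢
      exact ⟨hmem _ _ hp.1 hp.2, hval _ hp.1⟩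
    · intro p hp
      rw [Finset.mem_product] at hp ⊢
      exact ⟨hmem _ _ hp.1 hp.2, hval _ hp.1⟩
    · intro p _
      simp
    · intro p _
      simp
    · intro p _
      rfl
  rw [Finset.sum_product, Finset.sum_product] at h
  simp only [Finset.sum_const, nsmul_eq_mul, ← Finset.mul_sum] at h
  simp only [Finset.expect_eq_sum_div_card, ← Finset.sum_div, h]
  field_simp

variable {E : Type*} [NormedAddCommGroup E] [NormedSpace ℝ E]
  {M : Type*} [TopologicalSpace M] [ChartedSpace E M] [IsManifold 𝓘(ℝ, E) ∞ M]
  [RiemannianBundle (fun x : M ↦ TangentSpace 𝓘(ℝ, E) x)]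
    [IsContMDiffRiemannianBundle 𝓘(ℝ, E) ∞ E (fun x : M ↦ TangentSpace 𝓘(ℝ, E) x)]
  [FiniteDimensional ℝ E]

variable {n : ℕ} {f : Fin n → M → ℝ} {log : ∀ x _ : M, TangentSpace 𝓘(ℝ, E) x} {P : Params}
  {x₀ : M}

theorem run_congr {b b' : ℕ → Fin n → Fin n} {k : ℕ} (h : ∀ i < k, b i = b' i) :
    run f log P x₀ b k = run f log P x₀ b' k := by
  induction k with
  | zero => rfl
  | succ k ih => rw [run, run, ih fun i hi ↦ h i (hi.trans k.lt_succ_self), h k k.lt_succ_self]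

theorem run_t (b : ℕ → Fin n → Fin n) (k : ℕ) : (run f log P x₀ b k).t = k := by
  induction k with
  | zero => rfl
  | succ k ih => exact congrArg (· + 1) ih

theorem runFin_succ {N : ℕ} (o : Fin N → Fin n → Fin n) (k : Fin N) :
    runFin f log P x₀ o (k + 1) = pass f log P (o k) (runFin f log P x₀ o k) := by
  rw [runFin, run]
  simp [runFin]

theorem runFin_update {N : ℕ} (o : Fin N → Fin n → Fin n) (k : Fin N) (b : Fin n → Fin n) :
    runFin f log P x₀ (Function.update o k b) k = runFin f log P x₀ o k := by
  refine run_congr fun i hi ↦ ?_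
  have hiN : i < N := hi.trans k.2
  have hne : (⟨i, hiN⟩ : Fin N) ≠ k := fun h ↦ hi.ne (congrArg Fin.val h)
  simp [hiN, hne]

theorem runFin_t {N : ℕ} (o : Fin N → Fin n → Fin n) (k : ℕ) :
    (runFin f log P x₀ o k).t = k := run_t _ _

theorem runFin_isStep {N : ℕ} (o : Fin N → Fin n → Fin n) (k : ℕ) :
    (runFin f log P x₀ o (k + 1)).IsStep P.η := rfl

variable (f log P x₀) in
/-- The expectation of a function of the state after `k` of `N` passes. -/
def expectState (mode : Sampling) (N : ℕ) (ψ : State E M → ℝ) (k : ℕ) : ℝ :=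
  (outcomes mode n N).expect fun o ↦ ψ (runFin f log P x₀ o k)

/-- The list used in a pass is independent of the state before this pass. -/
theorem expectState_succ (mode : Sampling) {N k : ℕ} (hk : k < N) (ψ : State E M → ℝ) :
    expectState f log P x₀ mode N ψ (k + 1) = expectState f log P x₀ mode N
      (fun s ↦ (mode.draws n).expect fun b ↦ ψ (pass f log P b s)) k := by
  rw [expectState, expect_outcomes_update mode ⟨k, hk⟩]
  refine Finset.expect_congr rfl fun o _ ↦ Finset.expect_congr rfl fun b _ ↦ ?_
  have h1 := runFin_succ (f := f) (log := log) (P := P) (x₀ := x₀)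
    (Function.update o ⟨k, hk⟩ b) ⟨k, hk⟩
  rw [runFin_update, Function.update_self] at h1
  rw [h1]

theorem expectState_mono (mode : Sampling) {N k l : ℕ} {ψ ψ' : State E M → ℝ}
    (h : ∀ o : Fin N → Fin n → Fin n,
      ψ (runFin f log P x₀ o k) ≤ ψ' (runFin f log P x₀ o l)) :
    expectState f log P x₀ mode N ψ k ≤ expectState f log P x₀ mode N ψ' l :=
  Finset.expect_le_expect fun o _ ↦ h o

theorem expectState_add (mode : Sampling) {N k : ℕ} (ψ ψ' : State E M → ℝ) :
    expectState f log P x₀ mode N (fun s ↦ ψ s + ψ' s) k =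
      expectState f log P x₀ mode N ψ k + expectState f log P x₀ mode N ψ' k :=
  Finset.expect_add_distrib _ _ _

theorem expectState_const (mode : Sampling) {N k : ℕ} (c : ℝ) :
    expectState (E := E) f log P x₀ mode N (fun _ ↦ c) k = c :=
  Finset.expect_const (outcomes_nonempty mode n N) c

/-- The mean squared error of the estimator grows linearly in each period, from `0` in the full
batch pass. -/
theorem expectState_estimatorError_le (hM : GeodesicallyComplete E M) (hlog : IsInverseExp log)
    (mode : Sampling) (hn : 0 < n) {F : M → ℝ}
    (hF : ∀ x, F x = 1 / (n : ℝ) * ∑ i, f i x) (hf : ∀ i, GeodesicallySmooth E P.L (f i))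
    (hS₁ : P.S₁ = n) (hq : 0 < P.q) (hε : 0 < P.ε) {N k : ℕ} (hk : k < N) :
    expectState f log P x₀ mode N (estimatorError F) (k + 1) ≤
      ((k % P.q : ℕ) : ℝ) * (2 * P.ε ^ 2 / P.q) := by
  induction k with
  | zero =>
    rw [expectState_succ mode hk, Nat.zero_mod, Nat.cast_zero, zero_mul,
      ← expectState_const (E := E) (f := f) (log := log) (P := P) (x₀ := x₀) mode (N := N)
        (k := 0) 0]
    refine expectState_mono mode fun o ↦ ((Finset.expect_congr rfl fun b _ ↦
      estimatorError_pass_of_full hF (fun i ↦ (hf i).1) hS₁ ?_ b).trans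
        (Finset.expect_const_zero _)).le
    rw [runFin_t, Nat.zero_mod]
  | succ k ih =>
    rw [expectState_succ mode hk]
    by_cases h0 : (k + 1) % P.q = 0
    · rw [h0, Nat.cast_zero, zero_mul, ← expectState_const (E := E) (f := f) (log := log) (P := P)
        (x₀ := x₀) mode (N := N) (k := k + 1) 0]
      refine expectState_mono mode fun o ↦ ((Finset.expect_congr rfl fun b _ ↦
        estimatorError_pass_of_full hF (fun i ↦ (hf i).1) hS₁ ?_ b).trans
          (Finset.expect_const_zero _)).le
      rwa [runFin_t]
    · have h1 : ((k + 1) % P.q : ℕ) = k % P.q + 1 := by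
        rw [Nat.add_mod] at h0 ⊢
        have h2 := Nat.mod_lt k hq
        rcases Nat.lt_or_ge 1 P.q with h3 | h3
        · rw [Nat.mod_eq_of_lt h3] at h0 ⊢
          refine Nat.mod_eq_of_lt (lt_of_le_of_ne h2 fun h ↦ h0 ?_)
          rw [h, Nat.mod_self]
        · have : P.q = 1 := by omega
          simp [this, Nat.mod_one] at h0
      refine le_trans ?_ ((add_le_add_left (ih (by omega)) (2 * P.ε ^ 2 / P.q)).trans_eq ?_)
      · rw [← expectState_const (E := E) (f := f) (log := log) (P := P)
          (x₀ := x₀) mode (N := N) (k := k + 1) (2 * P.ε ^ 2 / P.q), ← expectState_add]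
        refine expectState_mono mode fun o ↦ ?_
        exact expect_estimatorError_pass_le hM hlog mode hn hF hf hq hε (by rwa [runFin_t])
          (runFin_isStep o k)
      · rw [h1]
        push_cast
        ring

/-- The remainders modulo `q` are at most `(q - 1) / 2` on average over an initial segment. -/
theorem two_mul_sum_mod_le {q : ℕ} (hq : 0 < q) (N : ℕ) :
    ∑ k ∈ Finset.range N, 2 * ((k % q : ℕ) : ℝ) ≤ N * (q - 1) := by
  -- an exact formula, in terms of the remainder `r` of `N`
  have h : ∑ k ∈ Finset.range N, 2 * ((k % q : ℕ) : ℝ) + ((N % q : ℕ) : ℝ) * (q - (N % q : ℕ)) =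
      N * (q - 1) := by
    induction N with
    | zero => simp
    | succ N ih =>
      rw [Finset.sum_range_succ]
      have h2 := Nat.mod_lt N hq
      rcases eq_or_lt_of_le (Nat.succ_le_of_lt h2) with h3 | h3
      · have h4 : (N + 1) % q = 0 := by
          rw [← Nat.mod_add_mod, ← Nat.succ_eq_add_one, h3, Nat.mod_self]
        have h5 : (q : ℝ) = (N % q : ℕ) + 1 := by exact_mod_cast h3.symm
        rw [h4]
        push_cast
        set r : ℝ := ((N % q : ℕ) : ℝ)
        rw [h5] at ih ⊢
        linarith
      · have h4 : (N + 1) % q = N % q + 1 := by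
          rw [← Nat.mod_add_mod, Nat.mod_eq_of_lt h3]
        rw [h4]
        push_cast
        linarith
  have h1 : ((N % q : ℕ) : ℝ) ≤ q := by exact_mod_cast (Nat.mod_lt N hq).le
  have h2 : 0 ≤ ((N % q : ℕ) : ℝ) * (q - (N % q : ℕ)) := mul_nonneg (by positivity) (by linarith)
  linarith

/-- There are at most `N / q + 1` multiples of `q` in `{0, …, N}`. -/
theorem mul_sum_ite_mod_le {q : ℕ} (hq : 0 < q) {N : ℕ} :
    (q : ℝ) * ∑ k ∈ Finset.range (N + 1), (if k % q = 0 then (1 : ℝ) else 0) ≤ N + q := by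
  -- an exact formula, in terms of the remainder of `N`
  have h : (q : ℝ) * ∑ k ∈ Finset.range (N + 1), (if k % q = 0 then (1 : ℝ) else 0)
      + ((N % q : ℕ) : ℝ) = N + q := by
    induction N with
    | zero =>
      rw [Finset.sum_range_one, Nat.zero_mod, if_pos rfl]
      simp
    | succ N ih =>
      rw [Finset.sum_range_succ]
      have h2 := Nat.mod_lt N hq
      rcases eq_or_lt_of_le (Nat.succ_le_of_lt h2) with h3 | h3
      · have h4 : (N + 1) % q = 0 := by
          rw [← Nat.mod_add_mod, ← Nat.succ_eq_add_one, h3, Nat.mod_self]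
        have h5 : (q : ℝ) = (N % q : ℕ) + 1 := by exact_mod_cast h3.symm
        rw [h4, if_pos rfl]
        push_cast
        linarith
      · have h4 : (N + 1) % q = N % q + 1 := by
          rw [← Nat.mod_add_mod, Nat.mod_eq_of_lt h3]
        rw [h4, if_neg (by omega)]
        push_cast
        linarith
  have : (0 : ℝ) ≤ ((N % q : ℕ) : ℝ) := by positivity
  linarith

end

/-! ### Total progress and total cost -/

section

variable {E : Type*} [NormedAddCommGroup E] [NormedSpace ℝ E]
  {M : Type*} [TopologicalSpace M] [ChartedSpace E M] [IsManifold 𝓘(ℝ, E) ∞ M]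
  [RiemannianBundle (fun x : M ↦ TangentSpace 𝓘(ℝ, E) x)]
    [IsContMDiffRiemannianBundle 𝓘(ℝ, E) ∞ E (fun x : M ↦ TangentSpace 𝓘(ℝ, E) x)]
  [FiniteDimensional ℝ E]

variable {n : ℕ} {f : Fin n → M → ℝ} {log : ∀ x _ : M, TangentSpace 𝓘(ℝ, E) x} {P : Params}
  {x₀ : M}

variable (f log P x₀) in
/-- The quantity `∑_{k < K} (‖∇F(x_k)‖² + ‖v_k‖² / 2)` that the decrease of the objective
controls. -/
def totalProgress (F : M → ℝ) {N : ℕ} (o : Fin N → Fin n → Fin n) (K : ℕ) : ℝ :=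
  ∑ k ∈ Finset.range K, (‖grad (E := E) F (runFin f log P x₀ o k).x‖ ^ 2 +
    estimatorNormSq (runFin f log P x₀ o (k + 1)) / 2)

theorem totalProgress_le (hM : GeodesicallyComplete E M) {F : M → ℝ}
    (hF : GeodesicallySmooth E P.L F) (hL : 0 < P.L) (hη : P.η = 1 / (2 * P.L)) {N : ℕ}
    (o : Fin N → Fin n → Fin n) {K : ℕ} (hK : K ≤ N) :
    totalProgress f log P x₀ F o K ≤ 4 * P.L * (F x₀ - F (runFin f log P x₀ o K).x) +
      ∑ k ∈ Finset.range K, estimatorError F (runFin f log P x₀ o (k + 1)) := by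
  induction K with
  | zero => simp [totalProgress, runFin, run, State.init]
  | succ K ih =>
    have h := objective_pass_le (f := f) (log := log) hM hF hL hη (runFin f log P x₀ o K)
      (o ⟨K, hK⟩)
    have hs := runFin_succ (f := f) (log := log) (P := P) (x₀ := x₀) o ⟨K, hK⟩
    dsimp only at hs
    rw [← hs] at h
    have ih := ih (by omega)
    rw [totalProgress, Finset.sum_range_succ, Finset.sum_range_succ]
    rw [totalProgress] at ih
    linarith

/-- The telescoped decrease of the objective: the errors of the estimators contribute less than
`ε²` per pass. -/
theorem expect_totalProgress_le (hM : GeodesicallyComplete E M) (hlog : IsInverseExp log)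
    (mode : Sampling) (hn : 0 < n) {F : M → ℝ}
    (hF : ∀ x, F x = 1 / (n : ℝ) * ∑ i, f i x) (hf : ∀ i, GeodesicallySmooth E P.L (f i))
    (hbdd : BddBelow (range F)) (hL : 0 < P.L) (hη : P.η = 1 / (2 * P.L))
    (hS₁ : P.S₁ = n) (hq : 0 < P.q) (hε : 0 < P.ε) {N K : ℕ} (hK : K ≤ N) :
    (outcomes mode n N).expect (fun o ↦ totalProgress f log P x₀ F o K) ≤
      4 * P.L * (F x₀ - ⨅ x, F x) + K * (P.q - 1) * (P.ε ^ 2 / P.q) := by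
  have h1 : (outcomes mode n N).expect (fun o ↦ totalProgress f log P x₀ F o K) ≤
      (outcomes mode n N).expect (fun o ↦ 4 * P.L * (F x₀ - ⨅ x, F x) +
        ∑ k ∈ Finset.range K, estimatorError F (runFin f log P x₀ o (k + 1))) := by
    refine Finset.expect_le_expect fun o _ ↦ ?_
    refine (totalProgress_le hM (GeodesicallySmooth.mean hn hF hf) hL hη o hK).trans ?_
    have := ciInf_le hbdd (runFin f log P x₀ o K).x
    gcongr
  refine h1.trans ?_
  rw [Finset.expect_add_distrib, Finset.expect_const (outcomes_nonempty mode n N),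
    Finset.expect_sum_comm]
  refine add_le_add_right ?_ _
  calc _ ≤ ∑ k ∈ Finset.range K, ((k % P.q : ℕ) : ℝ) * (2 * P.ε ^ 2 / P.q) :=
        Finset.sum_le_sum fun k hk ↦ expectState_estimatorError_le hM hlog mode hn hF hf hS₁ hq hε
          ((Finset.mem_range.1 hk).trans_le hK)
    _ = (∑ k ∈ Finset.range K, 2 * ((k % P.q : ℕ) : ℝ)) * (P.ε ^ 2 / P.q) := by
        rw [Finset.sum_mul]
        exact Finset.sum_congr rfl fun k _ ↦ by ring
    _ ≤ _ := mul_le_mul_of_nonneg_right (two_mul_sum_mod_le hq K) (by positivity)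

theorem sum_norm_grad_sq_le (hM : GeodesicallyComplete E M) {F : M → ℝ}
    (hF : GeodesicallySmooth E P.L F) (hL : 0 < P.L) (hη : P.η = 1 / (2 * P.L)) {N : ℕ}
    (o : Fin N → Fin n → Fin n) {K : ℕ} (hK : K ≤ N) :
    ∑ t ∈ Finset.Icc 1 K, ‖grad (E := E) F (runFin f log P x₀ o t).x‖ ^ 2 ≤
      3 / 2 * totalProgress f log P x₀ F o K := by
  rw [totalProgress, Finset.mul_sum]
  refine (Finset.sum_bij' (fun t _ ↦ t - 1) (fun k _ ↦ k + 1) (by simp; omega)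
    (by simp) (by simp +contextual) (by simp) fun t ht ↦ ?_).trans_le (Finset.sum_le_sum
      (f := fun k ↦ ‖grad (E := E) F (runFin f log P x₀ o (k + 1)).x‖ ^ 2) fun k hk ↦ ?_)
  · rw [Nat.sub_add_cancel (Finset.mem_Icc.1 ht).1]
  · have hk' : k < N := (Finset.mem_range.1 hk).trans_le hK
    have hs := runFin_succ (f := f) (log := log) (P := P) (x₀ := x₀) o ⟨k, hk'⟩
    dsimp only at hs
    rw [hs]
    exact norm_grad_pass_sq_le hM hF hL hη _ _

/-- The expected squared norm of the gradient at the output, for any positive number `T` of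
passes. -/
theorem mul_expectedSqGradNorm_le (hM : GeodesicallyComplete E M) (hlog : IsInverseExp log)
    (mode : Sampling) (hn : 0 < n) {F : M → ℝ}
    (hF : ∀ x, F x = 1 / (n : ℝ) * ∑ i, f i x) (hf : ∀ i, GeodesicallySmooth E P.L (f i))
    (hbdd : BddBelow (range F)) (hL : 0 < P.L) (hη : P.η = 1 / (2 * P.L))
    (hS₁ : P.S₁ = n) (hq : 0 < P.q) (hε : 0 < P.ε) {T : ℕ} (hT : 0 < T) :
    T * expectedSqGradNorm f log P mode x₀ T F ≤
      3 / 2 * (4 * P.L * (F x₀ - ⨅ x, F x) + T * P.ε ^ 2) := by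
  have hT' : (T : ℝ) ≠ 0 := by positivity
  have h1 := expect_totalProgress_le (x₀ := x₀) hM hlog mode hn hF hf hbdd hL hη hS₁ hq hε
    (le_refl T)
  have h2 : T * (P.q - 1) * (P.ε ^ 2 / P.q) ≤ T * P.ε ^ 2 := by
    have hq' : (0 : ℝ) < P.q := by exact_mod_cast hq
    rw [mul_assoc]
    refine mul_le_mul_of_nonneg_left ?_ (by positivity)
    rw [mul_div_assoc', div_le_iff₀ hq']
    nlinarith [sq_nonneg P.ε]
  have h3 : T * expectedSqGradNorm f log P mode x₀ T F ≤
      (outcomes mode n T).expect fun o ↦ 3 / 2 * totalProgress f log P x₀ F o T := by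
    rw [expectedSqGradNorm, Finset.mul_expect]
    refine Finset.expect_le_expect fun o _ ↦ ?_
    rw [Finset.expect_eq_sum_div_card, Nat.card_Icc, Nat.add_sub_cancel, mul_div_cancel₀ _ hT']
    exact sum_norm_grad_sq_le hM (GeodesicallySmooth.mean hn hF hf) hL hη o le_rfl
  rw [← Finset.mul_expect] at h3
  linarith

/-- The cost of the passes `0, …, K`: besides the full batches it is bounded by the lengths of the
steps `0, …, K - 1`, as the sample of a pass depends on the step before. -/
theorem calls_le (hlog : IsInverseExp log) (hL : 0 < P.L) (hη : P.η = 1 / (2 * P.L))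
    (hS₁ : P.S₁ = n) (hε : 0 < P.ε) (F : M → ℝ) {N : ℕ} (o : Fin N → Fin n → Fin n) {K : ℕ}
    (hK : K + 1 ≤ N) :
    ((runFin f log P x₀ o (K + 1)).calls : ℝ) ≤
      n * (∑ k ∈ Finset.range (K + 1), if k % P.q = 0 then (1 : ℝ) else 0) + 2 * K +
        P.q / (2 * P.ε ^ 2) * totalProgress f log P x₀ F o K := by
  induction K with
  | zero =>
    rw [runFin_succ o ⟨0, hK⟩, Finset.sum_range_one, Nat.zero_mod, if_pos rfl]
    simp [pass, runFin, run, State.init, passCalls, hS₁, totalProgress]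
  | succ K ih =>
    have ih := ih (by omega)
    set s := runFin f log P x₀ o (K + 1) with hs
    have h1 : (runFin f log P x₀ o (K + 1 + 1)).calls = s.calls + passCalls log P n s := by
      rw [runFin_succ o ⟨K + 1, hK⟩]
      rfl
    have ht : s.t = K + 1 := runFin_t o _
    have h2 : (passCalls log P n s : ℝ) ≤ n * (if (K + 1) % P.q = 0 then (1 : ℝ) else 0) + 2 +
        P.q / (4 * P.ε ^ 2) * estimatorNormSq s := by
      have h3 : 0 ≤ P.q / (4 * P.ε ^ 2) * estimatorNormSq s :=
        mul_nonneg (by positivity) (sq_nonneg _)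
      by_cases h0 : (K + 1) % P.q = 0
      · rw [passCalls, ht, if_pos h0, if_pos h0, hS₁]
        linarith
      · rw [if_neg h0, mul_zero, zero_add]
        exact passCalls_le hlog hL hη hε (by rwa [ht]) (runFin_isStep o K)
    have h4 : P.q / (4 * P.ε ^ 2) * estimatorNormSq s ≤ P.q / (2 * P.ε ^ 2) *
        (‖grad (E := E) F (runFin f log P x₀ o K).x‖ ^ 2 + estimatorNormSq s / 2) := by
      have h5 : P.q / (4 * P.ε ^ 2) * estimatorNormSq s =
          P.q / (2 * P.ε ^ 2) * (estimatorNormSq s / 2) := by field_simp; ring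
      rw [h5]
      have := sq_nonneg ‖grad (E := E) F (runFin f log P x₀ o K).x‖
      gcongr
      linarith
    have h5 : totalProgress f log P x₀ F o (K + 1) = totalProgress f log P x₀ F o K +
        (‖grad (E := E) F (runFin f log P x₀ o K).x‖ ^ 2 + estimatorNormSq s / 2) :=
      Finset.sum_range_succ _ _
    rw [h1, h5, Finset.sum_range_succ _ (K + 1)]
    push_cast
    linarith

/-- The expected number of calls in `K + 1` passes. The lower bound on `q` limits the cost of the
full batches, the upper bound that of the random samples. -/
theorem expectedCalls_lt (hM : GeodesicallyComplete E M) (hlog : IsInverseExp log)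
    (mode : Sampling) (hn : 0 < n) {F : M → ℝ}
    (hF : ∀ x, F x = 1 / (n : ℝ) * ∑ i, f i x) (hf : ∀ i, GeodesicallySmooth E P.L (f i))
    (hbdd : BddBelow (range F)) (hL : 0 < P.L) (hη : P.η = 1 / (2 * P.L))
    (hS₁ : P.S₁ = n) (hε : 0 < P.ε) (hq₁ : √n ≤ P.q) (hq₂ : P.q < √n + 1) {K : ℕ} {A : ℝ}
    (hA : A = 4 * P.L * (F x₀ - ⨅ x, F x) / P.ε ^ 2) (hA0 : 0 < A) (hKA : K ≤ A) :
    expectedCalls f log P mode x₀ (K + 1) < n + 2 * A * (3 + √n) := by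
  have hn' : (0 : ℝ) < n := by exact_mod_cast hn
  have hs : 0 < √n := Real.sqrt_pos.2 hn'
  have hq' : (0 : ℝ) < P.q := hs.trans_le hq₁
  have hq : 0 < P.q := by exact_mod_cast hq'
  have h1 := expect_totalProgress_le (x₀ := x₀) hM hlog mode hn hF hf hbdd hL hη hS₁ hq hε
    (Nat.le_succ K)
  have h2 : expectedCalls f log P mode x₀ (K + 1) ≤
      n * (∑ k ∈ Finset.range (K + 1), if k % P.q = 0 then (1 : ℝ) else 0) + 2 * K +
        P.q / (2 * P.ε ^ 2) *
          (outcomes mode n (K + 1)).expect fun o ↦ totalProgress f log P x₀ F o K := by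
    rw [Finset.mul_expect, ← Finset.expect_const (outcomes_nonempty mode n (K + 1))
      (n * (∑ k ∈ Finset.range (K + 1), if k % P.q = 0 then (1 : ℝ) else 0) + 2 * K),
      ← Finset.expect_add_distrib]
    exact Finset.expect_le_expect fun o _ ↦ calls_le hlog hL hη hS₁ hε F o le_rfl
  have h3 : n * (∑ k ∈ Finset.range (K + 1), if k % P.q = 0 then (1 : ℝ) else 0) ≤ n + √n * K := by
    have h4 := mul_sum_ite_mod_le hq (N := K)
    set m := ∑ k ∈ Finset.range (K + 1), if k % P.q = 0 then (1 : ℝ) else 0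
    have h5 : (n : ℝ) = √n * √n := (Real.mul_self_sqrt hn'.le).symm
    have h6 : (√n * √n) * m * P.q ≤ (√n * √n + √n * K) * P.q := by
      have h7 := mul_le_mul_of_nonneg_left h4 (mul_nonneg hs.le hs.le)
      have h8 : √n * K * √n ≤ √n * K * P.q := mul_le_mul_of_nonneg_left hq₁ (by positivity)
      linarith
    rw [← h5] at h6
    exact le_of_mul_le_mul_right h6 hq'
  have h9 : P.q / (2 * P.ε ^ 2) * (4 * P.L * (F x₀ - ⨅ x, F x) + K * (P.q - 1) * (P.ε ^ 2 / P.q)) =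
      P.q * A / 2 + K * (P.q - 1) / 2 := by
    rw [hA]
    field_simp
  have h10 := mul_le_mul_of_nonneg_left h1 (show 0 ≤ P.q / (2 * P.ε ^ 2) by positivity)
  rw [h9] at h10
  have hK0 : (0 : ℝ) ≤ K := K.cast_nonneg
  have hq1 : (1 : ℝ) ≤ P.q := by exact_mod_cast hq
  have h11 : √n * K ≤ √n * A := mul_le_mul_of_nonneg_left hKA hs.le
  have h12 : K * (P.q - 1) ≤ A * √n :=
    mul_le_mul hKA (by linarith) (by linarith) hA0.le
  have h13 : P.q * A ≤ (√n + 1) * A := mul_le_mul_of_nonneg_right hq₂.le hA0.le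
  linarith

end

end RSpider


end

theorem theorem2
    {E : Type*} [NormedAddCommGroup E] [NormedSpace ℝ E] [FiniteDimensional ℝ E]
    {M : Type*} [TopologicalSpace M] [T2Space M] [ChartedSpace E M] [IsManifold 𝓘(ℝ, E) ∞ M]
    [RiemannianBundle (fun x : M ↦ TangentSpace 𝓘(ℝ, E) x)]
    [IsContMDiffRiemannianBundle 𝓘(ℝ, E) ∞ E (fun x : M ↦ TangentSpace 𝓘(ℝ, E) x)]
    (hM : RSpider.GeodesicallyComplete E M)
    (log : ∀ x _ : M, TangentSpace 𝓘(ℝ, E) x) (hlog : RSpider.IsInverseExp log)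
    (mode : RSpider.Sampling)
    (n : ℕ) (hn : 0 < n) (f : Fin n → M → ℝ) (F : M → ℝ)
    (hF : ∀ x, F x = 1 / (n : ℝ) * ∑ i, f i x)
    (L : ℝ) (hL : 0 < L) (hsmooth : ∀ i, RSpider.GeodesicallySmooth E L (f i))
    (hbdd : BddBelow (Set.range F))
    (x₀ : M) (Δ : ℝ) (hΔ : Δ = F x₀ - ⨅ x, F x)
    (ε : ℝ) (hε : 0 < ε)
    (T : ℕ) (hT : T = ⌈4 * Δ * L / ε ^ 2⌉₊ ∨ T = ⌊4 * Δ * L / ε ^ 2⌋₊) (hT1 : 1 ≤ T)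
    (P : RSpider.Params)
    (hP : P = { S₁ := n, q := ⌈Real.sqrt n⌉₊, η := 1 / (2 * L), L := L, ε := ε }) :
    -- the pass counter reaches `T` after exactly `T` passes
    (∀ b : ℕ → Fin n → Fin n, IsLeast {k | T ≤ (RSpider.run f log P x₀ b k).t} T) ∧
    -- accuracy of the output
    RSpider.expectedSqGradNorm f log P mode x₀ T F ≤ 10 * ε ^ 2 ∧
    -- IFO calls of the `T` passes `t = 0, …, T - 1` that compute `x_1, …, x_T`
    RSpider.expectedCalls f log P mode x₀ T
      < n + 8 * Δ * L * (3 + Real.sqrt n) / ε ^ 2 ∧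
    -- for `T` not rounded up, the same bound with one further pass `t = T`
    ((T : ℝ) ≤ 4 * Δ * L / ε ^ 2 →
      RSpider.expectedCalls f log P mode x₀ (T + 1)
        < n + 8 * Δ * L * (3 + Real.sqrt n) / ε ^ 2) ∧
    -- in particular `O(n + √n / ε²)` calls
    RSpider.expectedCalls f log P mode x₀ T
      ≤ n + 32 * Δ * L * (Real.sqrt n / ε ^ 2) := by
  have hn' : (0 : ℝ) < n := by exact_mod_cast hn
  have hsq : 1 ≤ √(n : ℝ) := Real.one_le_sqrt.2 (by exact_mod_cast hn)
  have hε2 : 0 < ε ^ 2 := by positivity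
  have hq : 0 < P.q := by rw [hP]; exact Nat.ceil_pos.2 (by linarith)
  have hq₁ : √(n : ℝ) ≤ P.q := by rw [hP]; exact Nat.le_ceil _
  have hq₂ : P.q < √(n : ℝ) + 1 := by rw [hP]; exact Nat.ceil_lt_add_one (by linarith)
  have hPL : P.L = L := by rw [hP]
  have hPε : P.ε = ε := by rw [hP]
  have hPη : P.η = 1 / (2 * P.L) := by rw [hP]
  have hS₁ : P.S₁ = n := by rw [hP]
  rw [← hPL] at hsmooth hL
  rw [← hPε] at hε
  set A := 4 * Δ * L / ε ^ 2 with hA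
  have hA' : A = 4 * P.L * (F x₀ - ⨅ x, F x) / P.ε ^ 2 := by rw [hA, hΔ, hPL, hPε]; ring
  -- since `T` is positive, so is the number that was rounded
  have hA0 : 0 < A := by
    rcases hT with h | h
    · exact Nat.ceil_pos.1 (h ▸ hT1)
    · exact zero_lt_one.trans_le (Nat.floor_pos.1 (h ▸ hT1))
  have hTA : (T : ℝ) < A + 1 := by
    rcases hT with h | h
    · rw [h]
      exact Nat.ceil_lt_add_one hA0.le
    · rw [h]
      linarith [Nat.floor_le hA0.le]
  have hAT : A ≤ T + 1 := by
    rcases hT with h | h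
    · rw [h]
      linarith [Nat.le_ceil A]
    · rw [h]
      exact (Nat.lt_floor_add_one A).le
  have hT1' : (1 : ℝ) ≤ T := by exact_mod_cast hT1
  have hbound : 8 * Δ * L * (3 + √(n : ℝ)) / ε ^ 2 = 2 * A * (3 + √(n : ℝ)) := by
    rw [hA]
    ring
  have hcalls {K : ℕ} (hK : (K : ℝ) ≤ A) : RSpider.expectedCalls f log P mode x₀ (K + 1)
      < n + 8 * Δ * L * (3 + √(n : ℝ)) / ε ^ 2 :=
    hbound ▸ RSpider.expectedCalls_lt hM hlog mode hn hF hsmooth hbdd hL hPη hS₁ hε hq₁ hq₂ hA'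
      hA0 hK
  -- the `T` passes are pass `0` and `T - 1 < A` further ones, even if `T` is rounded up
  have hcallsT : RSpider.expectedCalls f log P mode x₀ T
      < n + 8 * Δ * L * (3 + √(n : ℝ)) / ε ^ 2 := by
    obtain ⟨K, rfl⟩ := Nat.exists_eq_add_of_le' hT1
    refine hcalls ?_
    push_cast at hTA
    linarith
  refine ⟨fun b ↦ ⟨(RSpider.run_t b T).ge, fun k hk ↦ hk.trans_eq (RSpider.run_t b k)⟩, ?_,
    hcallsT, hcalls, hcallsT.le.trans ?_⟩
  · have h := RSpider.mul_expectedSqGradNorm_le (x₀ := x₀) hM hlog mode hn hF hsmooth hbdd hL hPη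
      hS₁ hq hε hT1
    have h1 : 4 * P.L * (F x₀ - ⨅ x, F x) = A * ε ^ 2 := by
      rw [hA', hPε, div_mul_cancel₀ _ hε2.ne']
    rw [h1, hPε] at h
    have h2 : A * ε ^ 2 ≤ (2 * T) * ε ^ 2 := mul_le_mul_of_nonneg_right (by linarith) hε2.le
    refine le_of_mul_le_mul_left (h.trans ?_) (zero_lt_one.trans_le hT1')
    have h3 : 0 ≤ T * ε ^ 2 := by positivity
    linarith
  · rw [hbound]
    have h1 : 32 * Δ * L * (√(n : ℝ) / ε ^ 2) = 8 * A * √(n : ℝ) := by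
      rw [hA]
      ring
    have h2 : A * 1 ≤ A * √(n : ℝ) := mul_le_mul_of_nonneg_left hsq hA0.le
    rw [h1]
    linarith
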